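/- **Theorem 4.** Consider the $2\times 2$ MIMO X network in which transmitter $t\in\{1,2\}$ has $M_t$ antennas, receiver $r\in\{1,2\}$ has $N_r$ antennas, and each transmitter $t$ has an independent message $W_{rt}$ for each receiver $r$. The channel is constant: in every channel use $\mathbf y_r=\sum_{t}\mathbf H_{rt}\mathbf x_t+\mathbf z_r$ with $\mathbf H_{rt}\in\mathbb C^{N_r\times M_t}$ known to all nodes and $\mathbf z_r$ white $\mathcal{CN}(0,1)$ noise. The entries of the $\mathbf H_{rt}$ are independent circularly symmetric complex Gaussians, those of $\mathbf H_{rt}$ having a common variance $v_{rt}>0$. Degrees of freedom (DoF) $(d_{rt})$ are called achievable if there are rates $R_{rt}(\rho)$ that, for all large $\rho$, are achievable under average power constraint $\rho$ at each transmitter (block codes with at least $2^{nR_{rt}(\rho)}$ messages and error probability tending to $0$ as the block length $n\to\infty$), and $d_{rt}=\lim_{\rho\to\infty}R_{rt}(\rho)/\log_2\rho$. Suppose $N_1\ge N_2\ge M_1\ge M_2$ and $3M_2<N_1+N_2<2M_1+M_2$ (Case $A'$). Put $$Q_{11}=Q_{12}=N_1-N_2+M_2,\qquad Q_{21}=2(N_2-M_2),\qquad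 Q_{22}=N_2-N_1+M_2,$$ so that $\tfrac12(Q_{11}+Q_{12}+Q_{21}+Q_{22})=\tfrac12(N_1+N_2+M_2)$. Then for almost every channel realization the following hold. 1. There is an interference-alignment precoder with these block lengths: there are vectors $\mathbf v_{rt}^i\in\mathbb C^{M_t}$ ($1\le i\le Q_{rt}$), along which transmitter $t$ sends $Q_{rt}$ real symbols intended for receiver $r$, and numbers $A_1,A_2$ with $A_r\le Q_{r1},Q_{r2}$, such that for each receiver $r$, with $s$ the other receiver, $\mathbf H_{r1}\mathbf v_{s1}^i=\mathbf H_{r2}\mathbf v_{s2}^i$ for $i\le A_s$, and the received directions $\mathbf H_{rt}\mathbf v_{rt}^i$ ($t=1,2$, $i\le Q_{rt}$), $\mathbf H_{r1}\mathbf v_{s1}^i$ ($i\le Q_{s1}$), $\mathbf H_{r2}\mathbf v_{s2}^i$ ($A_s<i\le Q_{s2}$) are jointly linearly independent over $\mathbb R$. Linear precoding of real symbols with this precoder achieves the DoF $d_{rt}=Q_{rt}/2$, of total $\tfrac12(N_1+N_2+M_2)$. 2. This total is the outer bound: $\tfrac12(N_1+N_2+M_2)$ is the largest value of $d_{11}+d_{12}+d_{21}+d_{22}$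 over all achievable DoF $(d_{rt})$, with arbitrary coding schemes allowed. -/

import Mathlib

open scoped NNReal Matrix BigOperators

noncomputable section

namespace XChannel

open MeasureTheory ProbabilityTheory Filter Topology

/-- The circularly symmetric complex Gaussian law `CN(0, v)`: real and imaginary parts are
independent real centred Gaussians of variance `v / 2`. -/
def complexGaussian (v : ℝ≥0) : Measure ℂ :=
  ((gaussianReal 0 (v / 2)).prod (gaussianReal 0 (v / 2))).map
    Complex.measurableEquivRealProd.symm

instance (v : ℝ≥0) : IsProbabilityMeasure (complexGaussian v) :=
  Measure.isProbabilityMeasure_map Complex.measurableEquivRealProd.symm.measurable.aemeasurable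

/-- The channel coefficients of a 2 × 2 MIMO X network in which transmitter `t` has `M t` antennas
and receiver `r` has `N r` antennas: `H r t i j` is the (constant) gain from antenna `j` of
transmitter `t` to antenna `i` of receiver `r`. -/
abbrev Channel (M N : Fin 2 → ℕ) : Type :=
  ∀ r t : Fin 2, Fin (N r) → Fin (M t) → ℂ

/-- The law of the channel: all coefficients are independent, those of the link from transmitter
`t` to receiver `r` being `CN(0, v r t)`. -/
def channelLaw (M N : Fin 2 → ℕ) (v : Fin 2 → Fin 2 → ℝ≥0) : Measure (Channel M N) :=
  Measure.pi fun r => Measure.pi fun t => Measure.pi fun _ => Measure.pi fun _ =>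
    complexGaussian (v r t)

/-- The channel matrix of the link from transmitter `t` to receiver `r`. -/
def Channel.mat {M N : Fin 2 → ℕ} (H : Channel M N) (r t : Fin 2) :
    Matrix (Fin (N r)) (Fin (M t)) ℂ :=
  Matrix.of (H r t)

/-! ### Codes, rates and degrees of freedom -/

/-- A block code over `n` uses of the channel for four independent messages; the message from transmitter `t` to receiver `r` takes `K r t` values.
Transmitter `t` sees only its own two messages, receiver `r` only its own received block. -/
structure Code (M N : Fin 2 → ℕ) (n : ℕ) (K : Fin 2 → Fin 2 → ℕ) where
  /-- encoder of transmitter `t` -/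
  enc : ∀ t : Fin 2, (∀ r : Fin 2, Fin (K r t)) → Fin n → Fin (M t) → ℂ
  /-- decoder of receiver `r` -/
  dec : ∀ r : Fin 2, (Fin n → Fin (N r) → ℂ) → ∀ t : Fin 2, Fin (K r t)
  measurable_dec : ∀ r : Fin 2, Measurable (dec r)

/-- The law of the noise at receiver `r`: white over antennas and channel uses, `CN(0, 1)`. -/
def noiseLaw (N : Fin 2 → ℕ) (n : ℕ) (r : Fin 2) : Measure (Fin n → Fin (N r) → ℂ) :=
  Measure.pi fun _ => Measure.pi fun _ => complexGaussian 1

/-- The block received by `r` when the messages are `w` and the noise is `z`. -/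
def Code.output {M N : Fin 2 → ℕ} {n : ℕ} {K : Fin 2 → Fin 2 → ℕ} (c : Code M N n K)
    (H : Channel M N) (w : ∀ r t : Fin 2, Fin (K r t)) (r : Fin 2)
    (z : Fin n → Fin (N r) → ℂ) : Fin n → Fin (N r) → ℂ :=
  fun k => (∑ t, H.mat r t *ᵥ c.enc t (fun s => w s t) k) + z k

/-- The probability that receiver `r` decodes one of its two messages wrongly, the messages being
uniformly distributed and independent of the noise. -/
def Code.errorProb {M N : Fin 2 → ℕ} {n : ℕ} {K : Fin 2 → Fin 2 → ℕ} (c : Code M N n K)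
    (H : Channel M N) (r : Fin 2) : ℝ :=
  (∑ w : ∀ r t : Fin 2, Fin (K r t),
      (noiseLaw N n r).real {z | c.dec r (c.output H w r z) ≠ w r}) /
    (Fintype.card (∀ r t : Fin 2, Fin (K r t)) : ℝ)

/-- Average power at most `ρ` per transmitter, for every codeword. -/
def Code.HasPower {M N : Fin 2 → ℕ} {n : ℕ} {K : Fin 2 → Fin 2 → ℕ} (c : Code M N n K)
    (ρ : ℝ) : Prop :=
  ∀ t w, ∑ k, ∑ j, ‖c.enc t w k j‖ ^ 2 ≤ n * ρ

/-- A family of precoding vectors: the `i`-th of the `Q r t` real symbols intended for receiver `r`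
at transmitter `t` is sent along `V r t i`. -/
abbrev Precoder (M : Fin 2 → ℕ) (Q : Fin 2 → Fin 2 → ℕ) : Type :=
  ∀ r t : Fin 2, Fin (Q r t) → Fin (M t) → ℂ

/-- The code is a linear precoding scheme with precoder `V`: in every channel use the message from
`t` to `r` determines `Q r t` real symbols, and transmitter `t` sends the sum of these symbols
times their precoding vectors. -/
def Code.UsesPrecoder {M N : Fin 2 → ℕ} {n : ℕ} {K : Fin 2 → Fin 2 → ℕ} (c : Code M N n K)
    {Q : Fin 2 → Fin 2 → ℕ} (V : Precoder M Q) : Prop :=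
  ∃ s : ∀ r t : Fin 2, Fin (K r t) → Fin n → Fin (Q r t) → ℝ,
    ∀ t w k, c.enc t w k = ∑ r, ∑ i, s r t (w r) k i • V r t i

/-- The rates `R r t` (in bits per channel use) are achievable under the power constraint `ρ` by
codes belonging to the class `P`: for all large block lengths there are codes in `P` with at least
`2 ^ (n * R r t)` messages and arbitrarily small error probability. -/
def RatesAchievable {M N : Fin 2 → ℕ} (H : Channel M N)
    (P : ∀ (n : ℕ) (K : Fin 2 → Fin 2 → ℕ), Code M N n K → Prop)
    (ρ : ℝ) (R : Fin 2 → Fin 2 → ℝ) : Prop :=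
  (∀ r t, 0 ≤ R r t) ∧
  ∀ ε : ℝ, 0 < ε → ∀ᶠ n : ℕ in atTop, ∃ (K : Fin 2 → Fin 2 → ℕ) (c : Code M N n K),
    P n K c ∧ c.HasPower ρ ∧
    (∀ r t, (2 : ℝ) ^ ((n : ℝ) * R r t) ≤ K r t) ∧
    ∀ r, c.errorProb H r ≤ ε

/-- The degrees of freedom `d r t = lim R r t ρ / log₂ ρ` (as `ρ → ∞`) are achievable by codes in
the class `P`. -/
def DoFAchievableBy {M N : Fin 2 → ℕ} (H : Channel M N)
    (P : ∀ (n : ℕ) (K : Fin 2 → Fin 2 → ℕ), Code M N n K → Prop)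
    (d : Fin 2 → Fin 2 → ℝ) : Prop :=
  ∃ R : ℝ → Fin 2 → Fin 2 → ℝ,
    (∀ᶠ ρ in atTop, RatesAchievable H P ρ (R ρ)) ∧
    ∀ r t, Tendsto (fun ρ => R ρ r t / Real.logb 2 ρ) atTop (𝓝 (d r t))

/-- The degrees of freedom `d` are achievable by some codes. -/
def DoFAchievable {M N : Fin 2 → ℕ} (H : Channel M N) (d : Fin 2 → Fin 2 → ℝ) : Prop :=
  DoFAchievableBy H (fun _ _ _ => True) d

/-- The degrees of freedom `d` are achievable by linear precoding of real symbols with the fixed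
precoder `V`. -/
def DoFAchievableWith {M N : Fin 2 → ℕ} (H : Channel M N) {Q : Fin 2 → Fin 2 → ℕ}
    (V : Precoder M Q) (d : Fin 2 → Fin 2 → ℝ) : Prop :=
  DoFAchievableBy H (fun _ _ c => c.UsesPrecoder V) d

/-- The precoder aligns interference one-to-one and keeps signals separable. For each receiver
`r`, with `s = r.rev` the other receiver:

* the first `A s` symbols for `s` from transmitter `0` and the first `A s` symbols for `s` from
  transmitter `1` arrive at `r` along the same directions;
* at `r`, the directions of all desired symbols, of all interfering symbols from transmitter `0`
  and of the interfering symbols from transmitter `1` that have not been aligned are jointly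
  linearly independent over the reals. -/
structure IsAligned {M N : Fin 2 → ℕ} (H : Channel M N) {Q : Fin 2 → Fin 2 → ℕ}
    (V : Precoder M Q) (A : Fin 2 → ℕ) : Prop where
  le_length : ∀ s t, A s ≤ Q s t
  aligned : ∀ (r : Fin 2) (i : Fin (A r.rev)),
    H.mat r 0 *ᵥ V r.rev 0 (Fin.castLE (le_length r.rev 0) i) =
      H.mat r 1 *ᵥ V r.rev 1 (Fin.castLE (le_length r.rev 1) i)
  independent : ∀ r : Fin 2, LinearIndependent ℝ
    (Sum.elim (fun p : Σ t : Fin 2, Fin (Q r t) => H.mat r p.1 *ᵥ V r p.1 p.2)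
      (Sum.elim (fun i : Fin (Q r.rev 0) => H.mat r 0 *ᵥ V r.rev 0 i)
        (fun i : {i : Fin (Q r.rev 1) // A r.rev ≤ (i : ℕ)} => H.mat r 1 *ᵥ V r.rev 1 i)))

end XChannel

end

noncomputable section

namespace XChannel

open MeasureTheory ProbabilityTheory Filter Topology
open scoped ENNReal

/-! ### Densities of product Gaussian laws -/

/-! Transmitters and receivers are numbered 0 and 1, as in the code.

Converse. The total is bounded by adding d r 0 + d r 1 + d r.rev 0 ≤ N r for both receivers and d 0
1 + d 1 1 ≤ M 1, which counts every d twice. Each inequality comes from counting messages, without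
entropies. Suppose the noiseless outputs are a term depending on the messages w plus the image of a
D-dimensional input of energy O(nρ). Up to a factor (C ρ^D)^n, the output law is dominated by a
Gaussian mixture whose mixing variable does not depend on w (`jointLaw_shift_le`). In the mixture
all w compete at the same sample point; if at most L of them can be decoded there, the number of
message tuples is at most 2 (C ρ^D)^n L (`Code.card_le`). Taking logarithms gives a bound D on the
DoF of the remaining messages.

Alignment. Let K_r be the space of pairs of transmit vectors that coincide at receiver r. The
precoder consists of bases of X ≤ K_1 (symbols for receiver 0), Y ≤ K_0 (symbols for receiver 1),
and a space F of further vectors of transmitter 0 for receiver 1. Such spaces exist in sufficiently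
general position (`exists_alignment_subspaces`) once a few intersections have small dimension. These
dimensions are kernels of maps linear in the channel; generic rank is checked at one explicit 0-1
channel, because a nonzero polynomial vanishes only on a null set.

Achievability. Zero forcing reduces each real symbol to a scalar channel with additive noise.
Amplitude modulation with spacing log₂ ρ and about √ρ / log₂ ρ levels, protected by a
Gilbert–Varshamov code, carries half a degree of freedom (`IsAligned.dofAchievableWith`). -/

/-- Tonelli's theorem for products of functions of one coordinate. -/
theorem lintegral_fin_prod {n : ℕ} {E : Fin n → Type*} {mE : ∀ i, MeasurableSpace (E i)}
    {μ : ∀ i, Measure (E i)} [∀ i, SigmaFinite (μ i)] {f : ∀ i, E i → ℝ≥0∞}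
    (hf : ∀ i, Measurable (f i)) :
    ∫⁻ x : ∀ i, E i, ∏ i, f i (x i) ∂(Measure.pi μ) = ∏ i, ∫⁻ x, f i x ∂(μ i) := by
  induction n with
  | zero => simp [Measure.pi_empty_univ]
  | succ n ih =>
    have hm : Measurable fun y : ∀ i : Fin n, E i.succ => ∏ i : Fin n, f i.succ (y i) :=
      Finset.measurable_prod _ fun i _ => (hf i.succ).comp (measurable_pi_apply i)
    calc _ = ∫⁻ x : E 0 × (∀ i : Fin n, E i.succ), f 0 x.1 * ∏ i : Fin n, f i.succ (x.2 i)
            ∂((μ 0).prod (Measure.pi fun i => μ i.succ)) := by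
          refine ((((measurePreserving_piFinSuccAbove μ 0).symm _).lintegral_comp_emb
            (MeasurableEquiv.measurableEmbedding _) _).symm).trans (lintegral_congr fun x => ?_)
          rw [Fin.prod_univ_succ]
          rfl
      _ = (∫⁻ x, f 0 x ∂μ 0) * ∏ i : Fin n, ∫⁻ x, f i.succ x ∂(μ i.succ) := by
          rw [← ih (fun i => hf i.succ), ← lintegral_prod_mul (hf 0).aemeasurable hm.aemeasurable]
      _ = _ := by rw [Fin.prod_univ_succ]

/-- A product of measures with densities has the product density. -/
theorem pi_withDensity {n : ℕ} {E : Fin n → Type*} {mE : ∀ i, MeasurableSpace (E i)}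
    {μ ν : ∀ i, Measure (E i)} [∀ i, SigmaFinite (μ i)] [∀ i, SigmaFinite (ν i)]
    {f : ∀ i, E i → ℝ≥0∞} (hf : ∀ i, Measurable (f i)) (h : ∀ i, ν i = (μ i).withDensity (f i)) :
    Measure.pi ν = (Measure.pi μ).withDensity fun x => ∏ i, f i (x i) := by
  symm
  refine (Measure.pi_eq fun s hs => ?_).symm
  rw [withDensity_apply _ (MeasurableSet.univ_pi hs), Measure.restrict_pi_pi,
    lintegral_fin_prod hf]
  exact Finset.prod_congr rfl fun i _ => by rw [h i, withDensity_apply _ (hs i)]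

/-- The density of `CN(0, v)`. -/
theorem complexGaussian_eq_withDensity {v : ℝ≥0} (hv : v ≠ 0) :
    complexGaussian v = volume.withDensity
      fun z : ℂ => ENNReal.ofReal ((Real.pi * v)⁻¹ * Real.exp (-(‖z‖ ^ 2 / v))) := by
  have hv2 : v / 2 ≠ 0 := by positivity
  have hvpos : (0 : ℝ) < v := by positivity
  have hmap : (volume : Measure ℂ) =
      (volume : Measure (ℝ × ℝ)).map Complex.measurableEquivRealProd.symm :=
    (Complex.volume_preserving_equiv_real_prod.symm _).map_eq.symm
  have hsplit : ∀ p : ℝ × ℝ, gaussianPDF 0 (v / 2) p.1 * gaussianPDF 0 (v / 2) p.2 =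
      ENNReal.ofReal ((Real.pi * v)⁻¹ *
        Real.exp (-(‖Complex.measurableEquivRealProd.symm p‖ ^ 2 / v))) := by
    intro p
    rw [gaussianPDF, gaussianPDF, ← ENNReal.ofReal_mul (gaussianPDFReal_nonneg _ _ _)]
    congr 1
    have hn : ‖Complex.measurableEquivRealProd.symm p‖ ^ 2 = p.1 ^ 2 + p.2 ^ 2 := by
      rw [← Complex.normSq_eq_norm_sq, Complex.normSq_apply]
      simp [Complex.measurableEquivRealProd]; ring
    have hs : √(2 * Real.pi * ((v / 2 : ℝ≥0) : ℝ)) * √(2 * Real.pi * ((v / 2 : ℝ≥0) : ℝ)) =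
        Real.pi * v := by
      rw [Real.mul_self_sqrt (by positivity)]; push_cast; ring
    rw [gaussianPDFReal, gaussianPDFReal, hn]
    rw [mul_mul_mul_comm, ← mul_inv, hs, ← Real.exp_add]
    congr 2
    push_cast
    field_simp
    ring
  rw [complexGaussian, gaussianReal_of_var_ne_zero 0 hv2,
    prod_withDensity (measurable_gaussianPDF 0 _) (measurable_gaussianPDF 0 _)]
  ext s hs
  rw [Measure.map_apply Complex.measurableEquivRealProd.symm.measurable hs,
    withDensity_apply _ (Complex.measurableEquivRealProd.symm.measurable hs),
    withDensity_apply _ hs, hmap,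
    setLIntegral_map hs (by fun_prop) Complex.measurableEquivRealProd.symm.measurable]
  rw [← Measure.volume_eq_prod]
  exact lintegral_congr fun p => hsplit p

/-- The two-dimensional Gaussian integral. -/
theorem lintegral_exp_neg_mul_norm_sq {c : ℝ} (hc : 0 < c) :
    ∫⁻ z : ℂ, ENNReal.ofReal (Real.exp (-(c * ‖z‖ ^ 2))) = ENNReal.ofReal (Real.pi / c) := by
  have h := GaussianFourier.integral_rexp_neg_mul_sq_norm (V := ℂ) hc
  have h2 : ∫ z : ℂ, Real.exp (-(c * ‖z‖ ^ 2)) = Real.pi / c := by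
    simpa [Complex.finrank_real_complex] using h
  rw [← h2, ofReal_integral_eq_lintegral_ofReal]
  · by_contra hni
    rw [integral_undef hni] at h2
    exact (div_pos Real.pi_pos hc).ne h2
  · exact Eventually.of_forall fun z => (Real.exp_pos _).le

/-! ### Energy and Gaussian block laws. -/

/-- The energy of a block of complex vectors. -/
def energy {n D : ℕ} (x : Fin n → Fin D → ℂ) : ℝ := ∑ k, ∑ j, ‖x k j‖ ^ 2

theorem energy_nonneg {n D : ℕ} (x : Fin n → Fin D → ℂ) : 0 ≤ energy x := by
  unfold energy; positivity

@[fun_prop]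
theorem measurable_energy {n D : ℕ} : Measurable (energy (n := n) (D := D)) := by
  unfold energy; fun_prop

theorem energy_neg {n D : ℕ} (x : Fin n → Fin D → ℂ) : energy (-x) = energy x := by
  simp [energy]

theorem energy_parallelogram {n D : ℕ} (x y : Fin n → Fin D → ℂ) :
    energy (x + y) + energy (x - y) = 2 * energy x + 2 * energy y := by
  simp only [energy, ← Finset.sum_add_distrib, Finset.mul_sum]
  refine Finset.sum_congr rfl fun k _ => Finset.sum_congr rfl fun j _ => ?_
  have := parallelogram_law_with_norm ℝ (x k j) (y k j)
  simp only [Pi.add_apply, Pi.sub_apply]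
  nlinarith

/-- The law of a block of independent `CN(0, v)` variables. -/
def blockLaw (n D : ℕ) (v : ℝ≥0) : Measure (Fin n → Fin D → ℂ) :=
  Measure.pi fun _ => Measure.pi fun _ => complexGaussian v

instance (n D : ℕ) (v : ℝ≥0) : IsProbabilityMeasure (blockLaw n D v) := by
  unfold blockLaw; infer_instance

theorem noiseLaw_eq_blockLaw (N : Fin 2 → ℕ) (n : ℕ) (r : Fin 2) :
    noiseLaw N n r = blockLaw n (N r) 1 := rfl

/-- The density of `CN(0, v)`, as a function to `ℝ≥0∞`. -/
def gaussianDensity (v : ℝ≥0) (z : ℂ) : ℝ≥0∞ :=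
  ENNReal.ofReal ((Real.pi * v)⁻¹ * Real.exp (-(‖z‖ ^ 2 / v)))

theorem measurable_gaussianDensity (v : ℝ≥0) : Measurable (gaussianDensity v) := by
  unfold gaussianDensity; fun_prop

theorem pi_complexGaussian_eq_withDensity (D : ℕ) {v : ℝ≥0} (hv : v ≠ 0) :
    (Measure.pi fun _ : Fin D => complexGaussian v) =
      (volume : Measure (Fin D → ℂ)).withDensity fun x => ∏ j, gaussianDensity v (x j) :=
  pi_withDensity (fun _ => measurable_gaussianDensity v)
    fun _ => complexGaussian_eq_withDensity hv

theorem blockLaw_eq_withDensity_prod (n D : ℕ) {v : ℝ≥0} (hv : v ≠ 0) :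
    blockLaw n D v = volume.withDensity fun x => ∏ k, ∏ j, gaussianDensity v (x k j) :=
  pi_withDensity (E := fun _ : Fin n => Fin D → ℂ)
    (f := fun _ (y : Fin D → ℂ) => ∏ j, gaussianDensity v (y j))
    (fun _ => Finset.measurable_prod Finset.univ fun j _ =>
      (measurable_gaussianDensity v).comp (measurable_pi_apply j))
    fun _ => pi_complexGaussian_eq_withDensity D hv

theorem prod_gaussianDensity {n D : ℕ} (v : ℝ≥0) (x : Fin n → Fin D → ℂ) :
    ∏ k, ∏ j, gaussianDensity v (x k j) =
      ENNReal.ofReal ((Real.pi * v)⁻¹ ^ (n * D) * Real.exp (-(energy x / v))) := by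
  unfold gaussianDensity
  rw [← Finset.prod_congr rfl fun k _ => ENNReal.ofReal_prod_of_nonneg fun j _ => by positivity,
    ← ENNReal.ofReal_prod_of_nonneg fun k _ => Finset.prod_nonneg fun j _ => by positivity]
  congr 1
  simp only [Finset.prod_mul_distrib, Finset.prod_const, Finset.card_univ, Fintype.card_fin,
    ← Real.exp_sum]
  rw [← pow_mul, mul_comm D n]
  congr 2
  simp [energy, Finset.sum_div]

theorem blockLaw_eq_withDensity (n D : ℕ) {v : ℝ≥0} (hv : v ≠ 0) :
    blockLaw n D v = volume.withDensity
      fun x => ENNReal.ofReal ((Real.pi * v)⁻¹ ^ (n * D) * Real.exp (-(energy x / v))) := by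
  simp only [blockLaw_eq_withDensity_prod n D hv, prod_gaussianDensity]

theorem lintegral_exp_neg_mul_energy (n D : ℕ) {c : ℝ} (hc : 0 < c) :
    ∫⁻ x : Fin n → Fin D → ℂ, ENNReal.ofReal (Real.exp (-(c * energy x))) =
      ENNReal.ofReal (Real.pi / c) ^ (n * D) := by
  have hm : Measurable fun z : ℂ => ENNReal.ofReal (Real.exp (-(c * ‖z‖ ^ 2))) := by fun_prop
  have h1 : ∫⁻ x : Fin D → ℂ, ∏ j, ENNReal.ofReal (Real.exp (-(c * ‖x j‖ ^ 2))) =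
      ENNReal.ofReal (Real.pi / c) ^ D := by
    rw [volume_pi, lintegral_fin_prod fun _ => hm]
    simp [lintegral_exp_neg_mul_norm_sq hc]
  have h2 : ∫⁻ x : Fin n → Fin D → ℂ,
      ∏ k, ∏ j, ENNReal.ofReal (Real.exp (-(c * ‖x k j‖ ^ 2))) =
      ENNReal.ofReal (Real.pi / c) ^ (n * D) := by
    rw [volume_pi, lintegral_fin_prod (E := fun _ : Fin n => Fin D → ℂ)
      (f := fun _ y => ∏ j, ENNReal.ofReal (Real.exp (-(c * ‖y j‖ ^ 2)))) fun _ =>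
        Finset.measurable_prod Finset.univ fun j _ => hm.comp (measurable_pi_apply j)]
    simp [h1, ← pow_mul, mul_comm]
  rw [← h2]
  refine lintegral_congr fun x => ?_
  rw [← Finset.prod_congr rfl fun k _ => ENNReal.ofReal_prod_of_nonneg fun j _ => by positivity,
    ← ENNReal.ofReal_prod_of_nonneg fun k _ => Finset.prod_nonneg fun j _ => by positivity]
  congr 1
  simp only [← Real.exp_sum]
  congr 1
  simp [energy, Finset.mul_sum]

/-! ### Comparison of a shifted noise law with a Gaussian mixture of its shifts -/

/-- The joint law of the noise at both receivers. -/
def jointLaw (N : Fin 2 → ℕ) (n : ℕ) : Measure (∀ r, Fin n → Fin (N r) → ℂ) :=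
  Measure.pi fun r => noiseLaw N n r

instance (N : Fin 2 → ℕ) (n : ℕ) (r : Fin 2) : IsProbabilityMeasure (noiseLaw N n r) := by
  unfold noiseLaw; infer_instance

instance (N : Fin 2 → ℕ) (n : ℕ) : IsProbabilityMeasure (jointLaw N n) := by
  unfold jointLaw; infer_instance

/-- The total energy at both receivers. -/
def totalEnergy {N : Fin 2 → ℕ} {n : ℕ} (z : ∀ r, Fin n → Fin (N r) → ℂ) : ℝ :=
  ∑ r, energy (z r)

@[fun_prop]
theorem measurable_totalEnergy {N : Fin 2 → ℕ} {n : ℕ} :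
    Measurable (totalEnergy (N := N) (n := n)) := by
  unfold totalEnergy; fun_prop

theorem totalEnergy_parallelogram {N : Fin 2 → ℕ} {n : ℕ} (x y : ∀ r, Fin n → Fin (N r) → ℂ) :
    totalEnergy (x + y) + totalEnergy (x - y) = 2 * totalEnergy x + 2 * totalEnergy y := by
  simp only [totalEnergy, ← Finset.sum_add_distrib, Finset.mul_sum]
  exact Finset.sum_congr rfl fun r _ => energy_parallelogram (x r) (y r)

/-- The normalizing constant stands on both sides of the later comparison, so only its positivity is
recorded. -/
theorem exists_jointLaw_eq_withDensity (N : Fin 2 → ℕ) (n : ℕ) : ∃ κ : ℝ, 0 < κ ∧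
    jointLaw N n = volume.withDensity
      fun z => ENNReal.ofReal (κ * Real.exp (-totalEnergy z)) := by
  refine ⟨∏ r, (Real.pi * (1 : ℝ≥0))⁻¹ ^ (n * N r), by positivity, ?_⟩
  have h := pi_withDensity (E := fun r : Fin 2 => Fin n → Fin (N r) → ℂ)
    (ν := fun r => noiseLaw N n r)
    (f := fun r x => ENNReal.ofReal
      ((Real.pi * (1 : ℝ≥0))⁻¹ ^ (n * N r) * Real.exp (-(energy x / (1 : ℝ≥0)))))
    (fun r => by fun_prop) (fun r => blockLaw_eq_withDensity n (N r) one_ne_zero)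
  rw [jointLaw, h, ← volume_pi]
  refine congrArg (Measure.withDensity volume) (funext fun x => ?_)
  rw [← ENNReal.ofReal_prod_of_nonneg fun k _ => by positivity, Finset.prod_mul_distrib,
    ← Real.exp_sum]
  simp [totalEnergy]

/-- The signal produced at the receivers by a block of vectors through the matrices `G r`. -/
def spread {N : Fin 2 → ℕ} {D : ℕ} (G : ∀ r, Matrix (Fin (N r)) (Fin D) ℂ) {n : ℕ}
    (b : Fin n → Fin D → ℂ) : ∀ r, Fin n → Fin (N r) → ℂ :=
  fun r k => G r *ᵥ b k

theorem spread_add {N : Fin 2 → ℕ} {D : ℕ} (G : ∀ r, Matrix (Fin (N r)) (Fin D) ℂ) {n : ℕ}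
    (b b' : Fin n → Fin D → ℂ) : spread G (b + b') = spread G b + spread G b' := by
  funext r k; simp [spread, Matrix.mulVec_add]

theorem spread_neg {N : Fin 2 → ℕ} {D : ℕ} (G : ∀ r, Matrix (Fin (N r)) (Fin D) ℂ) {n : ℕ}
    (b : Fin n → Fin D → ℂ) : spread G (-b) = -spread G b := by
  funext r k; simp [spread, Matrix.mulVec_neg]

@[fun_prop]
theorem measurable_spread {N : Fin 2 → ℕ} {D : ℕ} (G : ∀ r, Matrix (Fin (N r)) (Fin D) ℂ)
    {n : ℕ} : Measurable (spread G (n := n)) := by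
  unfold spread Matrix.mulVec dotProduct
  fun_prop

/-- The squared Frobenius norm. -/
def frobeniusSq {m d : ℕ} (A : Matrix (Fin m) (Fin d) ℂ) : ℝ := ∑ i, ∑ j, ‖A i j‖ ^ 2

theorem frobeniusSq_nonneg {m d : ℕ} (A : Matrix (Fin m) (Fin d) ℂ) : 0 ≤ frobeniusSq A := by
  unfold frobeniusSq; positivity

/-- Cauchy–Schwarz in each row. -/
theorem energy_mulVec_le {m d n : ℕ} (A : Matrix (Fin m) (Fin d) ℂ) (x : Fin n → Fin d → ℂ) :
    energy (fun k => A *ᵥ x k) ≤ frobeniusSq A * energy x := by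
  unfold energy frobeniusSq
  rw [Finset.mul_sum]
  refine Finset.sum_le_sum fun k _ => ?_
  rw [Finset.sum_mul]
  refine Finset.sum_le_sum fun i _ => ?_
  calc ‖(A *ᵥ x k) i‖ ^ 2 ≤ (∑ j, ‖A i j‖ * ‖x k j‖) ^ 2 := by
        gcongr
        simp only [Matrix.mulVec, dotProduct]
        exact (norm_sum_le _ _).trans (by simp)
    _ ≤ _ := Finset.sum_mul_sq_le_sq_mul_sq _ _ _

theorem totalEnergy_spread_le {N : Fin 2 → ℕ} {D : ℕ} (G : ∀ r, Matrix (Fin (N r)) (Fin D) ℂ)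
    {n : ℕ} (b : Fin n → Fin D → ℂ) :
    totalEnergy (spread G b) ≤ (∑ r, frobeniusSq (G r)) * energy b := by
  rw [totalEnergy, Finset.sum_mul]
  exact Finset.sum_le_sum fun r _ => energy_mulVec_le (G r) b

theorem energy_add_le {n D : ℕ} (x y : Fin n → Fin D → ℂ) :
    energy (x + y) ≤ 2 * energy x + 2 * energy y := by
  have := energy_parallelogram x y
  have := energy_nonneg (x - y)
  linarith

/-- The arithmetic-geometric mean inequality for exp(-a) and exp(-b). -/
theorem two_mul_exp_le_exp_add_exp (a b : ℝ) :
    2 * Real.exp (-((a + b) / 2)) ≤ Real.exp (-a) + Real.exp (-b) := by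
  have h : Real.exp (-((a + b) / 2)) = Real.exp (-a / 2) * Real.exp (-b / 2) := by
    rw [← Real.exp_add]; congr 1; ring
  have ha : Real.exp (-a) = Real.exp (-a / 2) ^ 2 := by
    rw [← Real.exp_nat_mul]; congr 1; push_cast; ring
  have hb : Real.exp (-b) = Real.exp (-b / 2) ^ 2 := by
    rw [← Real.exp_nat_mul]; congr 1; push_cast; ring
  rw [h, ha, hb]
  nlinarith [sq_nonneg (Real.exp (-a / 2) - Real.exp (-b / 2))]

/-- Averaging the Gaussian density over symmetric shifts loses at most an exponential factor. -/
theorem le_lintegral_density_sub_spread {N : Fin 2 → ℕ} {D n : ℕ}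
    (G : ∀ r, Matrix (Fin (N r)) (Fin D) ℂ) {κ : ℝ} (hκ : 0 < κ)
    (y : ∀ r, Fin n → Fin (N r) → ℂ) :
    ENNReal.ofReal (Real.pi / (2 + ∑ r, frobeniusSq (G r))) ^ (n * D) *
        ENNReal.ofReal (κ * Real.exp (-totalEnergy y)) ≤
      ∫⁻ δ : Fin n → Fin D → ℂ, ENNReal.ofReal (Real.exp (-(2 * energy δ))) *
        ENNReal.ofReal (κ * Real.exp (-totalEnergy (y - spread G δ))) := by
  set g : ℝ := ∑ r, frobeniusSq (G r) with hg
  have hg0 : 0 ≤ g := Finset.sum_nonneg fun r _ => frobeniusSq_nonneg (G r)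
  set h : (Fin n → Fin D → ℂ) → ℝ≥0∞ := fun δ => ENNReal.ofReal (Real.exp (-(2 * energy δ))) *
        ENNReal.ofReal (κ * Real.exp (-totalEnergy (y - spread G δ))) with hh
  have hmeas : Measurable h := by
    rw [hh]; fun_prop
  have : (volume : Measure (Fin n → Fin D → ℂ)).IsNegInvariant :=
    Measure.pi.isNegInvariant (μ := fun _ => (volume : Measure (Fin D → ℂ)))
  -- Pairing δ with -δ reduces the claim to a pointwise bound: by the parallelogram law the mean
  -- energy of y ± Gδ is that of y plus that of Gδ, and the latter is at most g times the energy of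
  -- δ. Integrating exp(-(2 + g) energy δ) gives the constant.
  have hneg : ∫⁻ δ, h (-δ) = ∫⁻ δ, h δ := lintegral_neg_eq_self h
  have hpt : ∀ δ, 2 * (ENNReal.ofReal (κ * Real.exp (-totalEnergy y)) *
      ENNReal.ofReal (Real.exp (-((2 + g) * energy δ)))) ≤ h δ + h (-δ) := by
    intro δ
    simp only [hh]
    rw [energy_neg, spread_neg, sub_neg_eq_add, ← mul_add, ← ENNReal.ofReal_add (by positivity)
      (by positivity), ← ENNReal.ofReal_mul (by positivity), ← ENNReal.ofReal_mul (by positivity),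
      show (2 : ℝ≥0∞) = ENNReal.ofReal 2 by simp, ← ENNReal.ofReal_mul (by positivity)]
    refine ENNReal.ofReal_le_ofReal ?_
    have h1 := two_mul_exp_le_exp_add_exp (totalEnergy (y - spread G δ))
      (totalEnergy (y + spread G δ))
    have h2 := totalEnergy_parallelogram y (spread G δ)
    have h3 := totalEnergy_spread_le G δ
    have h4 : Real.exp (-totalEnergy y) * Real.exp (-((2 + g) * energy δ)) ≤
        Real.exp (-(2 * energy δ)) * Real.exp (-((totalEnergy (y - spread G δ) +
          totalEnergy (y + spread G δ)) / 2)) := by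
      rw [← Real.exp_add, ← Real.exp_add]
      refine Real.exp_le_exp.2 ?_
      linarith
    have h5 := Real.exp_pos (-(2 * energy δ))
    calc _ = κ * (2 * (Real.exp (-totalEnergy y) * Real.exp (-((2 + g) * energy δ)))) := by ring
      _ ≤ κ * (2 * (Real.exp (-(2 * energy δ)) * Real.exp (-((totalEnergy (y - spread G δ) +
          totalEnergy (y + spread G δ)) / 2)))) := by gcongr
      _ = κ * (Real.exp (-(2 * energy δ)) * (2 * Real.exp (-((totalEnergy (y - spread G δ) +
          totalEnergy (y + spread G δ)) / 2)))) := by ring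
      _ ≤ κ * (Real.exp (-(2 * energy δ)) * (Real.exp (-totalEnergy (y - spread G δ)) +
          Real.exp (-totalEnergy (y + spread G δ)))) := by gcongr
      _ = _ := by ring
  have hint := lintegral_mono (μ := volume) hpt
  rw [lintegral_add_left hmeas, hneg, lintegral_const_mul _ (by fun_prop),
    lintegral_const_mul _ (by fun_prop), lintegral_exp_neg_mul_energy n D (by positivity),
    ← two_mul] at hint
  rw [mul_comm]
  exact (ENNReal.mul_le_mul_iff_right two_ne_zero ENNReal.ofNat_ne_top).1 hint

/-- The law of a signal plus noise is dominated by the mixture of the laws of all signals in the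
same subspace under a Gaussian prior. -/
theorem jointLaw_shift_le {N : Fin 2 → ℕ} {D n : ℕ} (G : ∀ r, Matrix (Fin (N r)) (Fin D) ℂ)
    {B : ℝ≥0} (hB : 1 ≤ B) (c : ∀ r, Fin n → Fin (N r) → ℂ) (β : Fin n → Fin D → ℂ)
    (hβ : energy β ≤ n * B) {A : Set (∀ r, Fin n → Fin (N r) → ℂ)} (hA : MeasurableSet A) :
    jointLaw N n {z | c + spread G β + z ∈ A} ≤
      ENNReal.ofReal (Real.exp (2 * n) * ((2 + ∑ r, frobeniusSq (G r)) * B) ^ (n * D)) *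
        ∫⁻ b, jointLaw N n {z | c + spread G b + z ∈ A} ∂(blockLaw n D B) := by
  obtain ⟨κ, hκ, hlaw⟩ := exists_jointLaw_eq_withDensity N n
  set g : ℝ := ∑ r, frobeniusSq (G r) with hg
  have hg0 : 0 ≤ g := Finset.sum_nonneg fun r _ => frobeniusSq_nonneg (G r)
  have hB0 : (0 : ℝ) < B := by exact_mod_cast zero_lt_one.trans_le hB
  have hB1 : (1 : ℝ) ≤ B := by exact_mod_cast hB
  set f : (∀ r, Fin n → Fin (N r) → ℂ) → ℝ≥0∞ :=
    fun z => ENNReal.ofReal (κ * Real.exp (-totalEnergy z)) with hf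
  have hfm : Measurable f := by rw [hf]; fun_prop
  have hfs : ∀ s, Measurable fun y => f (y - s) := fun s => hfm.comp (measurable_sub_const s)
  have : (volume : Measure (∀ r, Fin n → Fin (N r) → ℂ)).IsAddLeftInvariant :=
    Measure.pi.isAddLeftInvariant (μ := fun r => (volume : Measure (Fin n → Fin (N r) → ℂ)))
  have hprob : ∀ s : ∀ r, Fin n → Fin (N r) → ℂ,
      jointLaw N n {z | s + z ∈ A} = ∫⁻ y in A, f (y - s) := by
    intro s
    have hm : MeasurableSet {z | s + z ∈ A} := (measurable_const_add s) hA
    rw [hlaw, withDensity_apply _ hm, ← lintegral_indicator hm, ← lintegral_indicator hA,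
      ← lintegral_add_left_eq_self (μ := volume) (A.indicator fun y => f (y - s)) s]
    refine lintegral_congr fun z => ?_
    by_cases hz : s + z ∈ A
    · rw [Set.indicator_of_mem (show z ∈ {z | s + z ∈ A} from hz), Set.indicator_of_mem hz,
        add_sub_cancel_left]
    · rw [Set.indicator_of_notMem (show z ∉ {z | s + z ∈ A} from hz),
        Set.indicator_of_notMem hz]
  have hint : Measurable fun b : Fin n → Fin D → ℂ => ∫⁻ y in A, f (y - (c + spread G b)) := by
    refine Measurable.lintegral_prod_right'
      (f := fun p : (Fin n → Fin D → ℂ) × (∀ r, Fin n → Fin (N r) → ℂ) =>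
        f (p.2 - (c + spread G p.1))) ?_
    exact hfm.comp (by fun_prop)
  -- The prior density at β + δ is at least a exp(-2 energy δ), because energy (β + δ) / B ≤ 2n + 2
  -- energy δ when energy β ≤ nB and B ≥ 1.
  set a : ℝ := (Real.pi * B)⁻¹ ^ (n * D) * Real.exp (-(2 * n)) with ha
  have hmix : ENNReal.ofReal a * (ENNReal.ofReal (Real.pi / (2 + g)) ^ (n * D) *
      jointLaw N n {z | c + spread G β + z ∈ A}) ≤
      ∫⁻ b, jointLaw N n {z | c + spread G b + z ∈ A} ∂(blockLaw n D B) := by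
    calc _ = ENNReal.ofReal a * ∫⁻ y in A, ENNReal.ofReal (Real.pi / (2 + g)) ^ (n * D) *
          f (y - (c + spread G β)) := by
          rw [hprob, lintegral_const_mul _ (hfs _)]
      _ ≤ ENNReal.ofReal a * ∫⁻ y in A, ∫⁻ δ : Fin n → Fin D → ℂ,
          ENNReal.ofReal (Real.exp (-(2 * energy δ))) *
            f (y - (c + spread G β) - spread G δ) := by
          gcongr with y
          exact le_lintegral_density_sub_spread G hκ _
      _ = ENNReal.ofReal a * ∫⁻ δ : Fin n → Fin D → ℂ, ∫⁻ y in A,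
          ENNReal.ofReal (Real.exp (-(2 * energy δ))) *
            f (y - (c + spread G β) - spread G δ) := by
          rw [lintegral_lintegral_swap]
          refine Measurable.aemeasurable ?_
          simp only [Function.uncurry_def]
          exact (by fun_prop : Measurable _).mul (hfm.comp (by fun_prop))
      _ = ∫⁻ δ : Fin n → Fin D → ℂ, ENNReal.ofReal (a * Real.exp (-(2 * energy δ))) *
            ∫⁻ y in A, f (y - (c + spread G (β + δ))) := by
          rw [← lintegral_const_mul']
          · refine lintegral_congr fun δ => ?_
            simp only [sub_sub _ _ (spread G δ), add_assoc, ← spread_add]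
            rw [lintegral_const_mul _ (hfs _), ← mul_assoc,
              ← ENNReal.ofReal_mul (by positivity)]
          · exact ENNReal.ofReal_ne_top
      _ ≤ ∫⁻ δ : Fin n → Fin D → ℂ, ENNReal.ofReal ((Real.pi * B)⁻¹ ^ (n * D) *
            Real.exp (-(energy (β + δ) / B))) * ∫⁻ y in A, f (y - (c + spread G (β + δ))) := by
          refine lintegral_mono fun δ => mul_le_mul_left (ENNReal.ofReal_le_ofReal ?_) _
          rw [ha, mul_assoc, ← Real.exp_add]
          refine mul_le_mul_of_nonneg_left (Real.exp_le_exp.2 ?_) (by positivity)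
          have h1 := energy_add_le β δ
          have h2 := energy_nonneg δ
          rw [← neg_add, neg_le_neg_iff, div_le_iff₀ hB0]
          nlinarith
      _ = ∫⁻ b : Fin n → Fin D → ℂ, ENNReal.ofReal ((Real.pi * B)⁻¹ ^ (n * D) *
            Real.exp (-(energy b / B))) * ∫⁻ y in A, f (y - (c + spread G b)) :=
          lintegral_add_left_eq_self (μ := volume) (fun b : Fin n → Fin D → ℂ =>
            ENNReal.ofReal ((Real.pi * B)⁻¹ ^ (n * D) *
            Real.exp (-(energy b / B))) * ∫⁻ y in A, f (y - (c + spread G b))) β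
      _ = ∫⁻ b, jointLaw N n {z | c + spread G b + z ∈ A} ∂(blockLaw n D B) := by
          rw [blockLaw_eq_withDensity n D (by positivity),
            lintegral_withDensity_eq_lintegral_mul _ (by fun_prop)]
          · simp only [hprob, Pi.mul_apply]
          · simp only [hprob]; exact hint
  have hconst : ENNReal.ofReal (Real.exp (2 * n) * ((2 + g) * B) ^ (n * D)) *
      (ENNReal.ofReal a * ENNReal.ofReal (Real.pi / (2 + g)) ^ (n * D)) = 1 := by
    rw [← ENNReal.ofReal_pow (by positivity), ← ENNReal.ofReal_mul (by positivity),
      ← ENNReal.ofReal_mul (by positivity), ← ENNReal.ofReal_one]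
    congr 1
    rw [ha, Real.exp_neg]
    have hne := (Real.exp_pos (2 * (n : ℝ))).ne'
    have : ((2 + g) * B) ^ (n * D) * ((Real.pi * B)⁻¹ ^ (n * D) * (Real.pi / (2 + g)) ^ (n * D))
        = 1 := by
      rw [← mul_pow, ← mul_pow]
      have : (2 + g) * B * ((Real.pi * B)⁻¹ * (Real.pi / (2 + g))) = 1 := by
        have := Real.pi_pos.ne'
        field_simp
      rw [this, one_pow]
    calc _ = (Real.exp (2 * n) * (Real.exp (2 * n))⁻¹) * (((2 + g) * B) ^ (n * D) *
        ((Real.pi * B)⁻¹ ^ (n * D) * (Real.pi / (2 + g)) ^ (n * D))) := by ring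
      _ = 1 := by rw [this, mul_inv_cancel₀ hne, one_mul]
  calc jointLaw N n {z | c + spread G β + z ∈ A}
      = ENNReal.ofReal (Real.exp (2 * n) * ((2 + g) * B) ^ (n * D)) *
      (ENNReal.ofReal a * ENNReal.ofReal (Real.pi / (2 + g)) ^ (n * D)) *
        jointLaw N n {z | c + spread G β + z ∈ A} := by rw [hconst, one_mul]
    _ = ENNReal.ofReal (Real.exp (2 * n) * ((2 + g) * B) ^ (n * D)) *
      (ENNReal.ofReal a * (ENNReal.ofReal (Real.pi / (2 + g)) ^ (n * D) *
        jointLaw N n {z | c + spread G β + z ∈ A})) := by rw [mul_assoc, mul_assoc]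
    _ ≤ _ := by gcongr

/-! ### Outer bounds -/

/-- If, for every fixed point of the signal space and every noise, at most `L` of the events occur,
then the sum of their probabilities under the actual signals is polynomially bounded. -/
theorem sum_jointLaw_le {W : Type*} [Fintype W] {N : Fin 2 → ℕ} {D n : ℕ}
    (G : ∀ r, Matrix (Fin (N r)) (Fin D) ℂ) {B : ℝ≥0} (hB : 1 ≤ B)
    (c : W → ∀ r, Fin n → Fin (N r) → ℂ) (β : W → Fin n → Fin D → ℂ)
    (hβ : ∀ w, energy (β w) ≤ n * B) (A : W → Set (∀ r, Fin n → Fin (N r) → ℂ))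
    (hA : ∀ w, MeasurableSet (A w)) (L : ℕ)
    (hL : ∀ y, ∀ s : Finset W, (∀ w ∈ s, c w + y ∈ A w) → s.card ≤ L) :
    ∑ w, jointLaw N n {z | c w + spread G (β w) + z ∈ A w} ≤
      ENNReal.ofReal (Real.exp (2 * n) * ((2 + ∑ r, frobeniusSq (G r)) * B) ^ (n * D)) * L := by
  classical
  have hmeas : ∀ w b, MeasurableSet {z | c w + spread G b + z ∈ A w} := fun w b =>
    (measurable_const_add _) (hA w)
  have hmeas2 : ∀ w, Measurable fun b => jointLaw N n {z | c w + spread G b + z ∈ A w} := by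
    intro w
    have : MeasurableSet {p : (Fin n → Fin D → ℂ) × (∀ r, Fin n → Fin (N r) → ℂ) |
        c w + spread G p.1 + p.2 ∈ A w} :=
      (show Measurable fun p : (Fin n → Fin D → ℂ) × (∀ r, Fin n → Fin (N r) → ℂ) =>
        c w + spread G p.1 + p.2 by fun_prop) (hA w)
    exact measurable_measure_prodMk_left this
  calc _ ≤ ∑ w, ENNReal.ofReal
        (Real.exp (2 * n) * ((2 + ∑ r, frobeniusSq (G r)) * B) ^ (n * D)) *
        ∫⁻ b, jointLaw N n {z | c w + spread G b + z ∈ A w} ∂(blockLaw n D B) :=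
        Finset.sum_le_sum fun w _ => jointLaw_shift_le G hB (c w) (β w) (hβ w) (hA w)
    _ = ENNReal.ofReal (Real.exp (2 * n) * ((2 + ∑ r, frobeniusSq (G r)) * B) ^ (n * D)) *
        ∫⁻ b, ∑ w, jointLaw N n {z | c w + spread G b + z ∈ A w} ∂(blockLaw n D B) := by
        rw [← Finset.mul_sum, lintegral_finsetSum _ fun w _ => hmeas2 w]
    _ ≤ ENNReal.ofReal (Real.exp (2 * n) * ((2 + ∑ r, frobeniusSq (G r)) * B) ^ (n * D)) *
        ∫⁻ _, L ∂(blockLaw n D B) := by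
        gcongr with b
        calc _ = ∫⁻ z, ∑ w, {z | c w + spread G b + z ∈ A w}.indicator (fun _ => (1 : ℝ≥0∞)) z
              ∂(jointLaw N n) := by
              rw [lintegral_finsetSum _ fun w _ => measurable_const.indicator (hmeas w b)]
              refine Finset.sum_congr rfl fun w _ => ?_
              rw [lintegral_indicator_const (hmeas w b), one_mul]
          _ ≤ ∫⁻ _, L ∂(jointLaw N n) := by
              gcongr with z
              -- The point b is now common to all w, so the sum counts the w whose event contains c
              -- w + y, with y = spread G b + z.
              have h1 : ∑ w, {z | c w + spread G b + z ∈ A w}.indicator (fun _ => (1 : ℝ≥0∞)) z =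
                  ((Finset.univ.filter fun w => c w + spread G b + z ∈ A w).card : ℝ≥0∞) := by
                rw [Finset.card_filter]
                push_cast
                exact Finset.sum_congr rfl fun w _ => by simp [Set.indicator_apply]
              rw [h1]
              exact_mod_cast hL (spread G b + z) _ fun w hw => by
                simpa [add_assoc] using hw
          _ = L := by simp
    _ = _ := by simp

section Converse

variable {M N : Fin 2 → ℕ} {n : ℕ} {K : Fin 2 → Fin 2 → ℕ}

theorem Code.measurable_output (c : Code M N n K) (H : Channel M N) (w : ∀ r t, Fin (K r t))
    (r : Fin 2) : Measurable (c.output H w r) := by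
  unfold Code.output
  fun_prop

/-- If both receivers have error probability at most `1/4`, then both of them are right with
average probability at least `1/2`. -/
theorem Code.card_le_sum_success (c : Code M N n K) (H : Channel M N)
    (herr : ∀ r, c.errorProb H r ≤ 1 / 4) :
    (Fintype.card (∀ r t : Fin 2, Fin (K r t)) : ℝ) ≤
      2 * ∑ w, (jointLaw N n).real {z | ∀ r, c.dec r (c.output H w r (z r)) = w r} := by
  set W : ℝ := (Fintype.card (∀ r t : Fin 2, Fin (K r t)) : ℝ) with hW
  have hW0 : 0 ≤ W := Nat.cast_nonneg _
  have hbad : ∀ r, ∑ w : ∀ r t : Fin 2, Fin (K r t),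
      (noiseLaw N n r).real {z | c.dec r (c.output H w r z) ≠ w r} ≤ W / 4 := by
    intro r
    have h := herr r
    rw [Code.errorProb] at h
    -- Without message tuples the error probability is the default value 0 / 0 = 0, but the sum is
    -- empty.
    rcases hW0.eq_or_lt with h0 | h0
    · have : IsEmpty (∀ r t : Fin 2, Fin (K r t)) := by
        rw [← Fintype.card_eq_zero_iff, ← Nat.cast_eq_zero (R := ℝ)]; exact h0.symm
      simpa using by positivity
    · rw [div_le_iff₀ h0] at h
      linarith
  have hone : ∀ w : ∀ r t : Fin 2, Fin (K r t),
      1 ≤ (jointLaw N n).real {z | ∀ r, c.dec r (c.output H w r (z r)) = w r} +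
        ∑ r, (noiseLaw N n r).real {z | c.dec r (c.output H w r z) ≠ w r} := by
    intro w
    have hS : ∀ r, MeasurableSet {z | c.dec r (c.output H w r z) ≠ w r} := fun r =>
      ((c.measurable_dec r).comp (c.measurable_output H w r)) (measurableSet_singleton _).compl
    have hmarg : ∀ r, (jointLaw N n).real {z | c.dec r (c.output H w r (z r)) ≠ w r} =
        (noiseLaw N n r).real {z | c.dec r (c.output H w r z) ≠ w r} := fun r =>
      (measurePreserving_eval (fun r => noiseLaw N n r) r).measureReal_preimage
        (hS r).nullMeasurableSet
    simp only [← hmarg, Fin.sum_univ_two]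
    have huniv : (Set.univ : Set (∀ r, Fin n → Fin (N r) → ℂ)) ⊆
        {z | ∀ r, c.dec r (c.output H w r (z r)) = w r} ∪
        ({z | c.dec 0 (c.output H w 0 (z 0)) ≠ w 0} ∪
          {z | c.dec 1 (c.output H w 1 (z 1)) ≠ w 1}) := by
      intro z _
      by_contra hz
      simp only [Set.mem_union, Set.mem_ofPred_eq, not_or, not_not, Fin.forall_fin_two] at hz
      exact hz.1 hz.2
    calc (1 : ℝ) = (jointLaw N n).real Set.univ := by simp
      _ ≤ _ := measureReal_mono huniv
      _ ≤ _ := (measureReal_union_le _ _).trans (by gcongr; exact measureReal_union_le _ _)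
  have hsum := Finset.sum_le_sum fun w (_ : w ∈ Finset.univ) => hone w
  rw [Finset.sum_add_distrib, Finset.sum_comm (s := Finset.univ) (t := (Finset.univ : Finset (Fin 2))),
    Fin.sum_univ_two] at hsum
  have h0 := hbad 0
  have h1 := hbad 1
  simp only [Finset.sum_const, Finset.card_univ, nsmul_eq_mul, mul_one] at hsum
  linarith

/-- The number of message tuples is polynomially bounded if, given a signal in the span of `G`,
at most `L` of them can be decoded correctly. -/
theorem Code.card_le (c : Code M N n K) (H : Channel M N) (herr : ∀ r, c.errorProb H r ≤ 1 / 4)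
    {D : ℕ} (G : ∀ r, Matrix (Fin (N r)) (Fin D) ℂ) {B : ℝ≥0} (hB : 1 ≤ B)
    (x : (∀ r t : Fin 2, Fin (K r t)) → ∀ r, Fin n → Fin (N r) → ℂ)
    (β : (∀ r t : Fin 2, Fin (K r t)) → Fin n → Fin D → ℂ)
    (hβ : ∀ w, energy (β w) ≤ n * B)
    (hout : ∀ w r z, c.output H w r z = x w r + spread G (β w) r + z) (L : ℕ)
    (hL : ∀ y : ∀ r, Fin n → Fin (N r) → ℂ, ∀ s : Finset (∀ r t : Fin 2, Fin (K r t)),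
      (∀ w ∈ s, ∀ r, c.dec r (x w r + y r) = w r) → s.card ≤ L) :
    (Fintype.card (∀ r t : Fin 2, Fin (K r t)) : ℝ) ≤
      2 * (Real.exp 2 * ((2 + ∑ r, frobeniusSq (G r)) * B) ^ D) ^ n * L := by
  have hg0 : 0 ≤ ∑ r, frobeniusSq (G r) := Finset.sum_nonneg fun r _ => frobeniusSq_nonneg (G r)
  have h1 := sum_jointLaw_le G hB x β hβ
    (fun w => {y | ∀ r, c.dec r (y r) = w r}) (fun w => by
      simp only [Set.ofPred_forall]
      exact MeasurableSet.iInter fun r =>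
        ((c.measurable_dec r).comp (measurable_pi_apply r)) (measurableSet_singleton (w r))) L
    (fun y s hs => hL y s hs)
  have h2 := c.card_le_sum_success H herr
  have h3 : ∑ w, (jointLaw N n).real {z | ∀ r, c.dec r (c.output H w r (z r)) = w r} ≤
      (Real.exp 2 * ((2 + ∑ r, frobeniusSq (G r)) * B) ^ D) ^ n * L := by
    have h4 := ENNReal.toReal_mono (by finiteness) h1
    rw [ENNReal.toReal_sum (fun w _ => by finiteness), ENNReal.toReal_mul,
      ENNReal.toReal_ofReal (by positivity), ENNReal.toReal_natCast] at h4
    refine (le_of_eq ?_).trans (h4.trans (le_of_eq ?_))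
    · refine Finset.sum_congr rfl fun w _ => ?_
      simp only [hout]
      rfl
    · rw [mul_pow (Real.exp 2), ← Real.exp_nat_mul, ← pow_mul, mul_comm D n, mul_comm (2 : ℝ)]
  calc _ ≤ _ := h2
    _ ≤ 2 * ((Real.exp 2 * ((2 + ∑ r, frobeniusSq (G r)) * B) ^ D) ^ n * L) := by gcongr
    _ = _ := by ring

theorem card_messages (K : Fin 2 → Fin 2 → ℕ) :
    (Fintype.card (∀ r t : Fin 2, Fin (K r t)) : ℝ) =
      K 0 0 * K 0 1 * (K 1 0 * K 1 1) := by
  simp [Fintype.card_pi, Fin.prod_univ_two]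

theorem Code.output_apply (c : Code M N n K) (H : Channel M N) (w : ∀ r t, Fin (K r t))
    (r : Fin 2) (z : Fin n → Fin (N r) → ℂ) (k : Fin n) :
    c.output H w r z k = H.mat r 0 *ᵥ c.enc 0 (fun s => w s 0) k +
      H.mat r 1 *ᵥ c.enc 1 (fun s => w s 1) k + z k := by
  simp [Code.output, Fin.sum_univ_two]

/-- Receiver `r`, knowing the message from the second transmitter to the other receiver, could also
decode the message from the first transmitter to the other receiver. -/
theorem exists_card_le_receiver (H : Channel M N) (r : Fin 2)
    (L : Matrix (Fin (M 0)) (Fin (N r)) ℂ) (hL : L * H.mat r 0 = 1) :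
    ∃ C : ℝ, 1 ≤ C ∧ ∀ ρ : ℝ, 1 ≤ ρ → ∀ (n : ℕ) (K : Fin 2 → Fin 2 → ℕ) (c : Code M N n K),
      c.HasPower ρ → (∀ s, c.errorProb H s ≤ 1 / 4) → (∀ s t, 0 < K s t) →
      (K r 0 * K r 1 * K r.rev 0 : ℝ) ≤ 2 * (C * ρ ^ N r) ^ n := by
  -- The common input will be the whole noiseless signal at r. Applying H s 0 * L to it restores the
  -- contribution of transmitter 0 at the other receiver, so the discrepancy there depends on the
  -- input of transmitter 1 alone.
  set G : ∀ s, Matrix (Fin (N s)) (Fin (N r)) ℂ :=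
    Function.update (fun s => H.mat s 0 * L) r 1 with hG
  have hGr : G r = 1 := by simp [hG]
  have hGs : ∀ s, G s * H.mat r 0 = H.mat s 0 := by
    intro s
    by_cases h : s = r
    · subst h; rw [hGr, Matrix.one_mul]
    · rw [hG, Function.update_of_ne h, Matrix.mul_assoc, hL, Matrix.mul_one]
  set g : ℝ := ∑ s, frobeniusSq (G s) with hg
  have hg0 : 0 ≤ g := Finset.sum_nonneg fun s _ => frobeniusSq_nonneg (G s)
  set f : ℝ := 2 * frobeniusSq (H.mat r 0) + 2 * frobeniusSq (H.mat r 1) with hf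
  have hf0 : 0 ≤ f := by
    have := frobeniusSq_nonneg (H.mat r 0)
    have := frobeniusSq_nonneg (H.mat r 1)
    positivity
  refine ⟨Real.exp 2 * ((2 + g) * (f + 1)) ^ N r, ?_, ?_⟩
  · exact one_le_mul_of_one_le_of_one_le (Real.one_le_exp (by norm_num))
      (one_le_pow₀ (by nlinarith))
  intro ρ hρ n K c hpow herr hK
  have hρ0 : 0 ≤ ρ := zero_le_one.trans hρ
  -- n f ρ bounds the energy of the signal at r; the summand 1 ensures B ≥ 1.
  obtain ⟨B, hB⟩ : ∃ B : ℝ≥0, (B : ℝ) = (f + 1) * ρ := ⟨⟨_, by positivity⟩, rfl⟩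
  have key := c.card_le H herr G (B := B)
    (by rw [← NNReal.coe_le_coe, hB]; push_cast; nlinarith)
    (fun w s k => (H.mat s 1 - G s * H.mat r 1) *ᵥ c.enc 1 (fun s => w s 1) k)
    (fun w => (fun k => H.mat r 0 *ᵥ c.enc 0 (fun s => w s 0) k) +
      fun k => H.mat r 1 *ᵥ c.enc 1 (fun s => w s 1) k)
    (fun w => by
      have e0 : energy (c.enc 0 fun s => w s 0) ≤ n * ρ := hpow 0 _
      have e1 : energy (c.enc 1 fun s => w s 1) ≤ n * ρ := hpow 1 _
      have f0 := frobeniusSq_nonneg (H.mat r 0)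
      have f1 := frobeniusSq_nonneg (H.mat r 1)
      have hn : (0 : ℝ) ≤ n * ρ := by positivity
      calc _ ≤ _ := energy_add_le _ _
        _ ≤ 2 * (frobeniusSq (H.mat r 0) * (n * ρ)) + 2 * (frobeniusSq (H.mat r 1) * (n * ρ)) := by
            gcongr
            · exact (energy_mulVec_le _ _).trans (by gcongr)
            · exact (energy_mulVec_le _ _).trans (by gcongr)
        _ = f * (n * ρ) := by rw [hf]; ring
        _ ≤ n * B := by rw [hB]; nlinarith)
    (fun w s z => by
      funext k
      rw [c.output_apply]
      simp only [spread, Pi.add_apply, Matrix.mulVec_add, Matrix.mulVec_mulVec, hGs,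
        Matrix.sub_mulVec]
      abel)
    (K r.rev 1)
    (fun y s hs => by
      have hcard := Finset.card_le_card_of_injOn (s := s) (t := (Finset.univ : Finset (Fin (K r.rev 1))))
        (fun w => w r.rev 1) (fun _ _ => Finset.mem_coe.2 (Finset.mem_univ _)) (by
          intro w hw w' hw' hww
          -- At r the term outside the common input vanishes, so y determines both messages for r.
          -- Together with w r.rev 1 they fix the input of transmitter 1, hence the other received
          -- block and its decoded messages.
          have hr : w r = w' r := by
            rw [← hs w hw r, ← hs w' hw' r]
            simp [hGr]
          have hx : (fun q => w q 1) = fun q => w' q 1 := by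
            funext q
            rcases (by fin_cases r <;> fin_cases q <;> simp : q = r ∨ q = r.rev) with rfl | rfl
            · rw [hr]
            · exact hww
          funext q
          rw [← hs w hw q, ← hs w' hw' q, hx])
      simpa using hcard)
  have hpos : (0 : ℝ) < K r.rev 1 := by exact_mod_cast hK _ _
  have hprod : (Fintype.card (∀ r t : Fin 2, Fin (K r t)) : ℝ) =
      (K r 0 * K r 1 * K r.rev 0) * K r.rev 1 := by
    rw [card_messages]
    fin_cases r <;> simp <;> ring
  rw [hprod] at key
  have := le_of_mul_le_mul_right key hpos
  refine this.trans (le_of_eq ?_)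
  rw [hB, ← mul_assoc (2 + g), mul_pow ((2 + g) * (f + 1)) ρ, mul_assoc]

/-- The two messages of the second transmitter are carried by its `M 1` antennas. -/
theorem exists_card_le_transmitter (H : Channel M N) :
    ∃ C : ℝ, 1 ≤ C ∧ ∀ ρ : ℝ, 1 ≤ ρ → ∀ (n : ℕ) (K : Fin 2 → Fin 2 → ℕ) (c : Code M N n K),
      c.HasPower ρ → (∀ s, c.errorProb H s ≤ 1 / 4) → (∀ s t, 0 < K s t) →
      (K 0 1 * K 1 1 : ℝ) ≤ 2 * (C * ρ ^ M 1) ^ n := by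
  set g : ℝ := ∑ s, frobeniusSq (H.mat s 1) with hg
  have hg0 : 0 ≤ g := Finset.sum_nonneg fun s _ => frobeniusSq_nonneg (H.mat s 1)
  refine ⟨Real.exp 2 * (2 + g) ^ M 1, ?_, ?_⟩
  · exact one_le_mul_of_one_le_of_one_le (Real.one_le_exp (by norm_num))
      (one_le_pow₀ (by linarith))
  intro ρ hρ n K c hpow herr hK
  obtain ⟨B, hB⟩ : ∃ B : ℝ≥0, (B : ℝ) = ρ := ⟨⟨ρ, zero_le_one.trans hρ⟩, rfl⟩
  have key := c.card_le H herr (fun s => H.mat s 1) (B := B)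
    (by rw [← NNReal.coe_le_coe, hB]; exact_mod_cast hρ)
    (fun w s k => H.mat s 0 *ᵥ c.enc 0 (fun s => w s 0) k)
    (fun w => c.enc 1 (fun s => w s 1))
    (fun w => hB ▸ hpow 1 _)
    (fun w s z => by funext k; rw [c.output_apply]; rfl)
    -- Once the input of transmitter 1 belongs to y, the two messages of transmitter 0 determine
    -- both received blocks.
    (K 0 0 * K 1 0)
    (fun y s hs => by
      have hcard := Finset.card_le_card_of_injOn (s := s)
        (t := (Finset.univ : Finset (∀ q : Fin 2, Fin (K q 0))))
        (fun w q => w q 0) (fun _ _ => Finset.mem_coe.2 (Finset.mem_univ _)) (by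
          intro w hw w' hw' hww
          funext q
          rw [← hs w hw q, ← hs w' hw' q]
          simp only at hww
          rw [hww])
      simpa [Fintype.card_pi, Fin.prod_univ_two] using hcard)
  have hpos : (0 : ℝ) < ((K 0 0 * K 1 0 : ℕ) : ℝ) := by
    exact_mod_cast Nat.mul_pos (hK _ _) (hK _ _)
  have hprod : (Fintype.card (∀ r t : Fin 2, Fin (K r t)) : ℝ) =
      (K 0 1 * K 1 1) * ((K 0 0 * K 1 0 : ℕ) : ℝ) := by
    rw [card_messages]
    push_cast
    ring
  rw [hprod] at key
  have := le_of_mul_le_mul_right key hpos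
  refine this.trans (le_of_eq ?_)
  rw [hB, mul_pow (2 + g) ρ, mul_assoc]

/-- A bound on the number of messages bounds the degrees of freedom. -/
theorem sum_dof_le (H : Channel M N) (S : Finset (Fin 2 × Fin 2)) (D : ℕ) {C : ℝ} (hC : 1 ≤ C)
    (h : ∀ ρ : ℝ, 1 ≤ ρ → ∀ (n : ℕ) (K : Fin 2 → Fin 2 → ℕ) (c : Code M N n K),
      c.HasPower ρ → (∀ s, c.errorProb H s ≤ 1 / 4) → (∀ s t, 0 < K s t) →
      ∏ p ∈ S, (K p.1 p.2 : ℝ) ≤ 2 * (C * ρ ^ D) ^ n)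
    {d : Fin 2 → Fin 2 → ℝ} (hd : DoFAchievable H d) : ∑ p ∈ S, d p.1 p.2 ≤ D := by
  obtain ⟨R, hR, hlim⟩ := hd
  have hsum : Tendsto (fun ρ => ∑ p ∈ S, R ρ p.1 p.2 / Real.logb 2 ρ) atTop
      (𝓝 (∑ p ∈ S, d p.1 p.2)) := tendsto_finsetSum _ fun p _ => hlim p.1 p.2
  have hlog : Tendsto (Real.logb 2) atTop atTop := Real.tendsto_logb_atTop (by norm_num)
  have hright : Tendsto (fun ρ => (1 + Real.logb 2 C) / Real.logb 2 ρ + D) atTop (𝓝 (0 + D)) :=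
    (hlog.const_div_atTop _).add_const _
  rw [zero_add] at hright
  refine le_of_tendsto_of_tendsto hsum hright ?_
  filter_upwards [hR, eventually_ge_atTop 2] with ρ hρ hρ2
  have hρ0 : 0 < ρ := by linarith
  have hl : 0 < Real.logb 2 ρ := Real.logb_pos (by norm_num) (by linarith)
  rw [← Finset.sum_div, div_add' _ _ _ hl.ne']
  refine div_le_div_of_nonneg_right ?_ hl.le
  -- One block length n ≥ 1 with error 1/4 is enough: after division by n the factor 2 costs at most
  -- one bit, which vanishes against log₂ ρ.
  obtain ⟨n, ⟨K, c, -, hpow, hK, herr⟩, hn⟩ :=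
    ((hρ.2 (1 / 4) (by norm_num)).and (eventually_ge_atTop 1)).exists
  have hn0 : (1 : ℝ) ≤ n := by exact_mod_cast hn
  have hKpos : ∀ s t, 0 < K s t := fun s t => by
    have : (0 : ℝ) < K s t := (Real.rpow_pos_of_pos (by norm_num) _).trans_le (hK s t)
    exact_mod_cast this
  have h1 := h ρ (by linarith) n K c hpow herr hKpos
  have h2 : (2 : ℝ) ^ (n * ∑ p ∈ S, R ρ p.1 p.2) ≤ 2 * (C * ρ ^ D) ^ n := by
    rw [Finset.mul_sum, Real.rpow_sum_of_pos (by norm_num : (0 : ℝ) < 2)]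
    exact (Finset.prod_le_prod (fun p _ => by positivity) fun p _ => hK p.1 p.2).trans h1
  have hC0 : 0 < C := by linarith
  have h3 := Real.logb_le_logb_of_le (b := 2) (by norm_num) (by positivity) h2
  rw [Real.logb_rpow (by norm_num) (by norm_num), Real.logb_mul (by norm_num) (by positivity),
    Real.logb_pow, Real.logb_mul hC0.ne' (by positivity), Real.logb_pow,
    Real.logb_self_eq_one (by norm_num)] at h3
  nlinarith

/-- The outer bound on the total degrees of freedom. -/
theorem total_dof_le (H : Channel M N) (L : ∀ r, Matrix (Fin (M 0)) (Fin (N r)) ℂ)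
    (hL : ∀ r, L r * H.mat r 0 = 1) {d : Fin 2 → Fin 2 → ℝ} (hd : DoFAchievable H d) :
    ∑ r, ∑ t, d r t ≤ ((N 0 : ℝ) + N 1 + M 1) / 2 := by
  have hrec : ∀ r : Fin 2, d r 0 + d r 1 + d r.rev 0 ≤ N r := by
    intro r
    obtain ⟨C, hC, h⟩ := exists_card_le_receiver H r (L r) (hL r)
    have := sum_dof_le H {(r, 0), (r, 1), (r.rev, 0)} (N r) hC (fun ρ hρ n K c h1 h2 h3 => by
      have := h ρ hρ n K c h1 h2 h3
      fin_cases r <;> simpa [mul_assoc] using this) hd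
    fin_cases r <;> simpa [add_assoc] using this
  have htr : d 0 1 + d 1 1 ≤ M 1 := by
    obtain ⟨C, hC, h⟩ := exists_card_le_transmitter H
    simpa using sum_dof_le H {(0, 1), (1, 1)} (M 1) hC (fun ρ hρ n K c h1 h2 h3 => by
      simpa using h ρ hρ n K c h1 h2 h3) hd
  have h0 : d 0 0 + d 0 1 + d 1 0 ≤ N 0 := hrec 0
  have h1 : d 1 0 + d 1 1 + d 0 0 ≤ N 1 := hrec 1
  simp only [Fin.sum_univ_two]
  linarith

end Converse

/-! ### Properties of almost every channel -/

/-- A measurable set that meets every line through some point in a null set is a null set. -/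
theorem measure_eq_zero_of_forall_line {E : Type*} [NormedAddCommGroup E] [NormedSpace ℝ E]
    [MeasurableSpace E] [BorelSpace E] [FiniteDimensional ℝ E] (μ : Measure E)
    [μ.IsAddHaarMeasure] {Z : Set E} (hZ : MeasurableSet Z) (x₀ : E)
    (h : ∀ x, volume {t : ℝ | x₀ + t • (x - x₀) ∈ Z} = 0) : μ Z = 0 := by
  have hS : MeasurableSet {p : ℝ × E | x₀ + p.1 • (p.2 - x₀) ∈ Z} :=
    (show Measurable fun p : ℝ × E => x₀ + p.1 • (p.2 - x₀) by fun_prop) hZ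
  -- Fubini in both orders: the set of pairs (t, x) is null along every x, hence almost every slice
  -- at fixed t is null. For t ≠ 0 the slice is the preimage of Z under an affine bijection.
  have hnull : (volume.prod μ) {p : ℝ × E | x₀ + p.1 • (p.2 - x₀) ∈ Z} = 0 := by
    rw [← Measure.prod_swap, Measure.map_apply measurable_swap hS,
      Measure.measure_prod_null (measurable_swap hS)]
    exact Eventually.of_forall fun x => h x
  have hae := Measure.measure_ae_null_of_prod_null hnull
  have hne : ∀ᵐ t : ℝ, t ≠ 0 := by simp [ae_iff]
  obtain ⟨t, ht, ht0⟩ := (hae.and hne).exists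
  have hpre : (Prod.mk t ⁻¹' {p : ℝ × E | x₀ + p.1 • (p.2 - x₀) ∈ Z}) =
      (fun x => x + -x₀) ⁻¹' ((fun x => t • x) ⁻¹' ((fun x => x₀ + x) ⁻¹' Z)) := by
    simp only [← sub_eq_add_neg]; rfl
  rw [Pi.zero_apply] at ht
  beta_reduce at ht
  rw [hpre, measure_preimage_add_right, Measure.addHaar_preimage_smul μ ht0,
    measure_preimage_add] at ht
  rcases mul_eq_zero.1 ht with h0 | h0
  · rw [ENNReal.ofReal_eq_zero] at h0
    exact absurd h0 (not_le.2 (by positivity))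
  · exact h0

/-- A matrix depending linearly on a parameter is invertible almost everywhere if it is invertible
somewhere. -/
theorem ae_det_ne_zero {E : Type*} [NormedAddCommGroup E] [NormedSpace ℝ E]
    [MeasurableSpace E] [BorelSpace E] [FiniteDimensional ℝ E] (μ : Measure E)
    [μ.IsAddHaarMeasure] {ι : Type*} [Fintype ι] [DecidableEq ι]
    (Φ : E →ₗ[ℝ] Matrix ι ι ℝ) (x₀ : E) (h : (Φ x₀).det ≠ 0) : ∀ᵐ x ∂μ, (Φ x).det ≠ 0 := by
  have hcont : Continuous fun x => (Φ x).det :=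
    (Φ.continuous_of_finiteDimensional).matrix_det
  rw [ae_iff]
  simp only [not_not]
  refine measure_eq_zero_of_forall_line μ
    (measurableSet_eq_fun hcont.measurable measurable_const) x₀ fun x => ?_
  -- On a line through x₀ the determinant is a polynomial in t that is nonzero at t = 0, so it has
  -- finitely many roots.
  set p : Polynomial ℝ := Matrix.det ((Φ x₀).map Polynomial.C +
    (Polynomial.X : Polynomial ℝ) • (Φ (x - x₀)).map Polynomial.C) with hp
  have heval : ∀ t : ℝ, p.eval t = (Φ (x₀ + t • (x - x₀))).det := by
    intro t
    rw [hp, ← Polynomial.coe_evalRingHom, RingHom.map_det]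
    congr 1
    ext i j
    simp [RingHom.mapMatrix_apply]
  have hp0 : p ≠ 0 := by
    rintro h0
    have := heval 0
    rw [h0] at this
    simp at this
    exact h this.symm
  refine (Set.Finite.subset (p.roots.toFinset.finite_toSet) fun t ht => ?_).measure_zero _
  simp only [Finset.mem_coe, Multiset.mem_toFinset, Polynomial.mem_roots hp0,
    Polynomial.IsRoot.def]
  rw [heval]
  exact ht

/-- Leaving the density existential allows iteration through the nested products; only absolute
continuity is wanted. -/
theorem exists_pi_eq_withDensity {n : ℕ} {E : Fin n → Type*} {mE : ∀ i, MeasurableSpace (E i)}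
    {μ ν : ∀ i, Measure (E i)} [∀ i, SigmaFinite (μ i)] [∀ i, SigmaFinite (ν i)]
    (h : ∀ i, ∃ f, Measurable f ∧ ν i = (μ i).withDensity f) :
    ∃ f, Measurable f ∧ Measure.pi ν = (Measure.pi μ).withDensity f := by
  choose f hf hν using h
  exact ⟨_, Finset.measurable_prod _ fun i _ => (hf i).comp (measurable_pi_apply i),
    pi_withDensity hf hν⟩

variable {M N : Fin 2 → ℕ}

theorem channelLaw_absolutelyContinuous {v : Fin 2 → Fin 2 → ℝ≥0} (hv : ∀ r t, v r t ≠ 0) :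
    channelLaw M N v ≪ volume := by
  have h1 : ∀ r t, ∃ f, Measurable f ∧
      (Measure.pi fun _ : Fin (M t) => complexGaussian (v r t)) = volume.withDensity f :=
    fun r t => ⟨_, Finset.measurable_prod _ fun j _ =>
      (measurable_gaussianDensity _).comp (measurable_pi_apply j),
      pi_complexGaussian_eq_withDensity (M t) (hv r t)⟩
  have h2 : ∀ r t, ∃ f, Measurable f ∧
      (Measure.pi fun _ : Fin (N r) => Measure.pi fun _ : Fin (M t) => complexGaussian (v r t)) =
        (Measure.pi fun _ : Fin (N r) => (volume : Measure (Fin (M t) → ℂ))).withDensity f :=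
    fun r t => exists_pi_eq_withDensity fun _ => h1 r t
  have h3 : ∀ r, ∃ f, Measurable f ∧
      (Measure.pi fun t => Measure.pi fun _ : Fin (N r) => Measure.pi fun _ : Fin (M t) =>
        complexGaussian (v r t)) =
        (Measure.pi fun t => Measure.pi fun _ : Fin (N r) =>
          (volume : Measure (Fin (M t) → ℂ))).withDensity f :=
    fun r => exists_pi_eq_withDensity fun t => h2 r t
  obtain ⟨f, -, hf⟩ := exists_pi_eq_withDensity h3
  rw [channelLaw, hf]
  exact withDensity_absolutelyContinuous _ _

theorem isAddHaarMeasure_volume_channel :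
    (volume : Measure (Channel M N)).IsAddHaarMeasure := by
  have h1 := fun r t => Measure.pi.isAddHaarMeasure
    (μ := fun _ : Fin (N r) => (volume : Measure (Fin (M t) → ℂ)))
  have h2 := fun r => Measure.pi.isAddHaarMeasure
    (μ := fun t => (volume : Measure (Fin (N r) → Fin (M t) → ℂ)))
  exact Measure.pi.isAddHaarMeasure
    (μ := fun r => Measure.pi fun t => (volume : Measure (Fin (N r) → Fin (M t) → ℂ)))

/-- Bijectivity is nonvanishing of a determinant that is polynomial in H and equals 1 at H₀.
Injectivity and surjectivity reduce to it by composition with a one-sided inverse of Φ H₀. -/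
theorem ae_bijective {V : Type*} [AddCommGroup V] [Module ℝ V] [FiniteDimensional ℝ V]
    {v : Fin 2 → Fin 2 → ℝ≥0} (hv : ∀ r t, v r t ≠ 0)
    (Φ : Channel M N →ₗ[ℝ] V →ₗ[ℝ] V) {H₀ : Channel M N} (h : Φ H₀ = LinearMap.id) :
    ∀ᵐ H ∂(channelLaw M N v), Function.Bijective (Φ H) := by
  have := isAddHaarMeasure_volume_channel (M := M) (N := N)
  refine (channelLaw_absolutelyContinuous hv).ae_le ?_
  set b := Module.finBasis ℝ V
  have hdet := ae_det_ne_zero (volume : Measure (Channel M N))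
    ((LinearMap.toMatrix b b).toLinearMap ∘ₗ Φ) H₀ (by simp [h])
  filter_upwards [hdet] with H hH
  rw [LinearMap.comp_apply, LinearEquiv.coe_coe, LinearMap.det_toMatrix] at hH
  rw [← Module.End.isUnit_iff, LinearMap.isUnit_iff_isUnit_det]
  exact hH.isUnit

/-- A linear map depending linearly on the channel is injective for almost every channel if it is
injective for some channel. -/
theorem ae_injective {V V' : Type*} [AddCommGroup V] [Module ℝ V] [FiniteDimensional ℝ V]
    [AddCommGroup V'] [Module ℝ V'] {v : Fin 2 → Fin 2 → ℝ≥0} (hv : ∀ r t, v r t ≠ 0)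
    (Φ : Channel M N →ₗ[ℝ] V →ₗ[ℝ] V') {H₀ : Channel M N} (h : Function.Injective (Φ H₀)) :
    ∀ᵐ H ∂(channelLaw M N v), Function.Injective (Φ H) := by
  obtain ⟨π, hπ⟩ := (Φ H₀).exists_leftInverse_of_injective (LinearMap.ker_eq_bot.2 h)
  filter_upwards [ae_bijective hv (LinearMap.llcomp ℝ V V' V π ∘ₗ Φ) (H₀ := H₀) hπ] with H hH
  exact Function.Injective.of_comp (f := π) hH.1

/-- A linear map depending linearly on the channel is surjective for almost every channel if it is
surjective for some channel. -/
theorem ae_surjective {V V' : Type*} [AddCommGroup V] [Module ℝ V]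
    [AddCommGroup V'] [Module ℝ V'] [FiniteDimensional ℝ V'] {v : Fin 2 → Fin 2 → ℝ≥0}
    (hv : ∀ r t, v r t ≠ 0)
    (Φ : Channel M N →ₗ[ℝ] V →ₗ[ℝ] V') {H₀ : Channel M N} (h : Function.Surjective (Φ H₀)) :
    ∀ᵐ H ∂(channelLaw M N v), Function.Surjective (Φ H) := by
  obtain ⟨ι, hι⟩ := (Φ H₀).exists_rightInverse_of_surjective (LinearMap.range_eq_top.2 h)
  filter_upwards [ae_bijective hv (LinearMap.lcomp ℝ V' ι ∘ₗ Φ) (H₀ := H₀) hι] with H hH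
  exact Function.Surjective.of_comp (g := ι) hH.2

/-! ### Link maps and their generic rank. -/

/-- The action of the link from transmitter `t` to receiver `r`, as a function of the channel. -/
def link (M N : Fin 2 → ℕ) (r t : Fin 2) :
    Channel M N →ₗ[ℝ] (Fin (M t) → ℂ) →ₗ[ℝ] (Fin (N r) → ℂ) :=
  LinearMap.mk₂ ℝ (fun H u => H.mat r t *ᵥ u)
    (fun H H' u => Matrix.add_mulVec (H.mat r t) (H'.mat r t) u)
    (fun a H u => Matrix.smul_mulVec a (H.mat r t) u)
    (fun _ u u' => Matrix.mulVec_add _ u u') (fun a _ u => Matrix.mulVec_smul _ a u)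

theorem link_apply (r t : Fin 2) (H : Channel M N) (u : Fin (M t) → ℂ) :
    link M N r t H u = H.mat r t *ᵥ u := rfl

/-- The signals at both receivers when transmitter `t` sends the same signal `p.1` to both of them,
and the other transmitter a separate signal `p.2 r` to each. -/
def sharedLink (M N : Fin 2 → ℕ) (t : Fin 2) :
    Channel M N →ₗ[ℝ] ((Fin (M t) → ℂ) × (Fin 2 → Fin (M t.rev) → ℂ)) →ₗ[ℝ]
      (∀ r, Fin (N r) → ℂ) :=
  LinearMap.mk₂ ℝ (fun H p r => link M N r t H p.1 + link M N r t.rev H (p.2 r))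
    (fun H H' p => by funext r; simp only [map_add, LinearMap.add_apply, Pi.add_apply]; abel)
    (fun a H p => by funext r; simp only [map_smul, LinearMap.smul_apply, Pi.smul_apply, smul_add])
    (fun H p p' => by
      funext r; simp only [Prod.fst_add, Prod.snd_add, map_add, Pi.add_apply]; abel)
    (fun a H p => by
      funext r; simp only [Prod.smul_fst, Prod.smul_snd, map_smul, Pi.smul_apply, smul_add])

theorem sharedLink_apply (t : Fin 2) (H : Channel M N)
    (p : (Fin (M t) → ℂ) × (Fin 2 → Fin (M t.rev) → ℂ)) (r : Fin 2) :
    sharedLink M N t H p r = H.mat r t *ᵥ p.1 + H.mat r t.rev *ᵥ p.2 r := rfl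

/-- A row of a partial permutation matrix selects one coordinate or none; all explicit channels
below have such rows. -/
theorem sum_ite_val_eq {n : ℕ} (P : Prop) [Decidable P] (e : ℕ) (u : Fin n → ℂ) :
    ∑ j : Fin n, (if P ∧ (j : ℕ) = e then (1 : ℂ) else 0) * u j =
      if h : P ∧ e < n then u ⟨e, h.2⟩ else 0 := by
  split_ifs with h
  · rw [Finset.sum_eq_single (⟨e, h.2⟩ : Fin n)]
    · simp [h.1]
    · intro j _ hj
      rw [if_neg fun h' => hj (Fin.ext h'.2), zero_mul]
    · simp
  · refine Finset.sum_eq_zero fun j _ => ?_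
    rw [if_neg fun h' : P ∧ (j : ℕ) = e => h ⟨h'.1, h'.2 ▸ j.2⟩, zero_mul]

/-- The witness is an identity block on the first M t antennas. -/
theorem ae_link_injective {v : Fin 2 → Fin 2 → ℝ≥0} (hv : ∀ r t, v r t ≠ 0) {r t : Fin 2}
    (h : M t ≤ N r) : ∀ᵐ H ∂(channelLaw M N v), Function.Injective (link M N r t H) := by
  refine ae_injective hv _ (H₀ := fun _ _ i j => if True ∧ (j : ℕ) = i then 1 else 0) ?_
  rw [← LinearMap.ker_eq_bot, LinearMap.ker_eq_bot']
  intro u hu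
  funext j
  have := congrFun hu (Fin.castLE h j)
  rw [link_apply] at this
  simp only [Channel.mat, Matrix.mulVec, dotProduct, Matrix.of_apply, sum_ite_val_eq] at this
  simpa using this

/-- A channel of partial permutation matrices in which transmitter `t.rev` reaches the first
`M t.rev` antennas of each receiver and transmitter `t` the remaining ones. -/
def splitChannel (M N : Fin 2 → ℕ) (t : Fin 2) : Channel M N := fun r t' i j =>
  if t' = t then
    -- At receiver 1 the inputs continue after the N 0 - M t.rev ones used at receiver 0: j = (i - M
    -- t.rev) + (N 0 - M t.rev).
    if M t.rev ≤ i ∧ (j : ℕ) = (if r = 0 then i - M t.rev else i + N 0 - 2 * M t.rev : ℕ) then 1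
    else 0
  else if True ∧ (j : ℕ) = i then 1 else 0

theorem sharedLink_splitChannel (t : Fin 2) (p : (Fin (M t) → ℂ) × (Fin 2 → Fin (M t.rev) → ℂ))
    (r : Fin 2) (i : Fin (N r)) :
    sharedLink M N t (splitChannel M N t) p r i =
      (if h : M t.rev ≤ i ∧
          (if r = 0 then i - M t.rev else i + N 0 - 2 * M t.rev : ℕ) < M t
        then p.1 ⟨_, h.2⟩ else 0) +
      (if h : True ∧ (i : ℕ) < M t.rev then p.2 r ⟨i, h.2⟩ else 0) := by
  have hne : t.rev ≠ t := by fin_cases t <;> simp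
  rw [sharedLink_apply]
  simp only [Pi.add_apply, Channel.mat, Matrix.mulVec, dotProduct, Matrix.of_apply, splitChannel,
    if_true, if_neg hne, sum_ite_val_eq]

/-- In `splitChannel` the antennas not covered by transmitter t.rev number N 0 + N 1 - 2 M t.rev,
and transmitter t has an input for each of them. -/
theorem ae_sharedLink_surjective {v : Fin 2 → Fin 2 → ℝ≥0} (hv : ∀ r t, v r t ≠ 0) {t : Fin 2}
    (h : ∀ r, M t.rev ≤ N r) (h2 : N 0 + N 1 ≤ 2 * M t.rev + M t) :
    ∀ᵐ H ∂(channelLaw M N v), Function.Surjective (sharedLink M N t H) := by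
  refine ae_surjective hv _ (H₀ := splitChannel M N t) fun y => ?_
  have h0 := h 0
  have h1 := h 1
  refine ⟨(fun j => if hj : M t.rev + j < N 0 then y 0 ⟨M t.rev + j, hj⟩ else
    if hj' : 2 * M t.rev + j - N 0 < N 1 then y 1 ⟨2 * M t.rev + j - N 0, hj'⟩ else 0,
    fun r j => y r (Fin.castLE (h r) j)), ?_⟩
  funext r i
  rw [sharedLink_splitChannel]
  have hi := i.2
  by_cases him : (i : ℕ) < M t.rev
  · rw [dif_neg (fun h' => absurd h'.1 (not_le.2 him)), dif_pos ⟨trivial, him⟩, zero_add]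
    rfl
  · rw [dif_neg (fun h' : True ∧ _ => him h'.2), add_zero]
    match r, i, hi, him with
    | 0, i, hi, him =>
      rw [dif_pos ⟨by lia, by simp only [if_true]; lia⟩]
      simp only [if_true]
      rw [dif_pos (by lia)]
      congr 1
      exact Fin.ext (by simp only; lia)
    | 1, i, hi, him =>
      have h10 : (1 : Fin 2) ≠ 0 := by decide
      rw [dif_pos ⟨by lia, by simp only [if_neg h10]; lia⟩]
      simp only [if_neg h10]
      rw [dif_neg (by lia), dif_pos (by lia)]
      congr 1
      exact Fin.ext (by simp only; lia)

/-- With the opposite inequality every input of transmitter t reaches an antenna of its own in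
`splitChannel`. -/
theorem ae_sharedLink_injective {v : Fin 2 → Fin 2 → ℝ≥0} (hv : ∀ r t, v r t ≠ 0) {t : Fin 2}
    (h : ∀ r, M t.rev ≤ N r) (h2 : 2 * M t.rev + M t ≤ N 0 + N 1) :
    ∀ᵐ H ∂(channelLaw M N v), Function.Injective (sharedLink M N t H) := by
  refine ae_injective hv _ (H₀ := splitChannel M N t) ?_
  rw [← LinearMap.ker_eq_bot, LinearMap.ker_eq_bot']
  intro p hp
  have h0 := h 0
  have h1 := h 1
  refine Prod.ext (funext fun j => ?_) (funext fun r => funext fun j => ?_)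
  · have hj := j.2
    by_cases hj0 : M t.rev + j < N 0
    · have := congrFun (congrFun hp 0) ⟨M t.rev + j, hj0⟩
      rw [sharedLink_splitChannel, dif_pos ⟨by simp only; lia, by simp only [if_true]; lia⟩,
        dif_neg (by simp only; lia), add_zero] at this
      refine Eq.trans (congrArg p.1 (Fin.ext ?_)) this
      simp only [if_true]; lia
    · have h10 : (1 : Fin 2) ≠ 0 := by decide
      have := congrFun (congrFun hp 1) ⟨2 * M t.rev + j - N 0, by lia⟩
      rw [sharedLink_splitChannel,
        dif_pos ⟨by simp only; lia, by simp only [if_neg h10]; lia⟩,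
        dif_neg (by simp only; lia), add_zero] at this
      refine Eq.trans (congrArg p.1 (Fin.ext ?_)) this
      simp only [if_neg h10]; lia
  · have := congrFun (congrFun hp r) (Fin.castLE (h r) j)
    have hj := j.2
    rw [sharedLink_splitChannel, dif_neg (by simp only [Fin.val_castLE]; lia),
      dif_pos ⟨trivial, hj⟩, zero_add] at this
    exact this

/-! ### Subspaces in general position -/

/-- Take s outside S and t outside T; if neither already works, s + t does. -/
theorem exists_notMem_notMem {V : Type*} [AddCommGroup V] [Module ℝ V] {S T : Submodule ℝ V} (hS : S ≠ ⊤) (hT : T ≠ ⊤) :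
    ∃ v, v ∉ S ∧ v ∉ T := by
  obtain ⟨s, -, hs⟩ := SetLike.exists_of_lt hS.lt_top
  obtain ⟨t, -, ht⟩ := SetLike.exists_of_lt hT.lt_top
  by_contra! h
  have hsT := h s hs
  have htS : t ∈ S := by
    by_contra h'
    exact ht (h t h')
  have h1 : s + t ∉ S := fun h' => hs ((S.add_mem_iff_left htS).1 h')
  exact ht ((T.add_mem_iff_right hsT).1 (h _ h1))

section GeneralPosition

variable {V : Type*} [AddCommGroup V] [Module ℝ V] [FiniteDimensional ℝ V]

open Module

theorem finrank_add_le_of_disjoint {S T K : Submodule ℝ V} (hS : S ≤ K) (hT : T ≤ K)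
    (h : Disjoint S T) : finrank ℝ S + finrank ℝ T ≤ finrank ℝ K := by
  have h1 := Submodule.finrank_sup_add_finrank_inf_eq S T
  rw [h.eq_bot, finrank_bot, add_zero] at h1
  rw [← h1]
  exact Submodule.finrank_mono (sup_le hS hT)

/-- Two subspaces of codimension at least `k` have a common independent subspace of
dimension `k`. -/
theorem exists_disjoint_disjoint (k : ℕ) (S T : Submodule ℝ V)
    (hS : finrank ℝ S + k ≤ finrank ℝ V) (hT : finrank ℝ T + k ≤ finrank ℝ V) :
    ∃ Y : Submodule ℝ V, finrank ℝ Y = k ∧ Disjoint Y S ∧ Disjoint Y T := by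
  induction k generalizing S T with
  | zero => exact ⟨⊥, finrank_bot ℝ V, disjoint_bot_left, disjoint_bot_left⟩
  | succ k ih =>
    have hne : ∀ S : Submodule ℝ V, finrank ℝ S + (k + 1) ≤ finrank ℝ V → S ≠ ⊤ := by
      rintro S hS rfl
      rw [finrank_top] at hS
      lia
    obtain ⟨v, hvS, hvT⟩ := exists_notMem_notMem (hne S hS) (hne T hT)
    have hv : v ≠ 0 := fun h => hvS (h ▸ S.zero_mem)
    have hspan : finrank ℝ (Submodule.span ℝ {v}) = 1 := finrank_span_singleton hv
    have hrank : ∀ S : Submodule ℝ V, finrank ℝ S + (k + 1) ≤ finrank ℝ V →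
        finrank ℝ ↥(S ⊔ Submodule.span ℝ {v}) + k ≤ finrank ℝ V := by
      intro S hS
      have := Submodule.finrank_add_le_finrank_add_finrank S (Submodule.span ℝ {v})
      lia
    -- The induction hypothesis is applied to both subspaces enlarged by v, so that v can be added
    -- to Y afterwards.
    obtain ⟨Y, hY, hYS, hYT⟩ := ih _ _ (hrank S hS) (hrank T hT)
    have hdis : ∀ S : Submodule ℝ V, v ∉ S → Disjoint Y (S ⊔ Submodule.span ℝ {v}) →
        Disjoint (Y ⊔ Submodule.span ℝ {v}) S := by
      intro S hvS hYS
      have h1 : Disjoint S (Submodule.span ℝ {v}) := (Submodule.disjoint_span_singleton' hv).2 hvS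
      exact (h1.disjoint_sup_right_of_disjoint_sup_left hYS.symm).symm.mono_left
        (le_of_eq (sup_comm _ _))
    refine ⟨Y ⊔ Submodule.span ℝ {v}, ?_, hdis S hvS hYS, hdis T hvT hYT⟩
    have h2 := Submodule.finrank_sup_add_finrank_inf_eq Y (Submodule.span ℝ {v})
    rw [(hYS.mono_right le_sup_right).eq_bot, finrank_bot, hspan, hY] at h2
    exact h2

/-- The relative version of `exists_disjoint_disjoint`. -/
theorem exists_le_disjoint_disjoint (k : ℕ) (K S T : Submodule ℝ V)
    (hS : finrank ℝ ↥(K ⊓ S) + k ≤ finrank ℝ K) (hT : finrank ℝ ↥(K ⊓ T) + k ≤ finrank ℝ K) :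
    ∃ Y ≤ K, finrank ℝ Y = k ∧ Disjoint Y S ∧ Disjoint Y T := by
  have hcomap : ∀ S : Submodule ℝ V,
      finrank ℝ (S.comap K.subtype) = finrank ℝ ↥(K ⊓ S) := by
    intro S
    rw [← Submodule.map_comap_subtype]
    exact (Submodule.finrank_map_subtype_eq K _).symm
  obtain ⟨Y, hY, hYS, hYT⟩ := exists_disjoint_disjoint k (S.comap K.subtype) (T.comap K.subtype)
    (by rw [hcomap]; exact hS) (by rw [hcomap]; exact hT)
  have hdis : ∀ S : Submodule ℝ V, Disjoint Y (S.comap K.subtype) →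
      Disjoint (Y.map K.subtype) S := by
    intro S h
    rw [Submodule.disjoint_def] at h ⊢
    rintro _ ⟨y, hy, rfl⟩ hyS
    rw [h y hy hyS, map_zero]
  exact ⟨Y.map K.subtype, Submodule.map_subtype_le K Y,
    by rw [Submodule.finrank_map_subtype_eq, hY], hdis S hYS, hdis T hYT⟩

end GeneralPosition

/-! ### Choice of the alignment subspaces, and separability. -/

section Alignment

variable {U W : Type*} [AddCommGroup U] [Module ℝ U] [FiniteDimensional ℝ U]
  [AddCommGroup W] [Module ℝ W] [FiniteDimensional ℝ W]

open Module

/-- The subspaces spanned by the precoding vectors. -/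
theorem exists_alignment_subspaces {a b f m : ℕ} {K₀ K₁ : Submodule ℝ (U × W)}
    (hK₀ : finrank ℝ K₀ = b + m) (hK₁ : finrank ℝ K₁ = a + m)
    (hsnd : ∀ x ∈ K₁, x.2 = 0 → x = 0)
    (hS₀ : finrank ℝ ↥(K₀ ⊓ (K₁.map (LinearMap.fst ℝ U W)).comap (LinearMap.fst ℝ U W)) ≤ m)
    (hS₁ : finrank ℝ ↥(K₁ ⊓ (K₀.map (LinearMap.fst ℝ U W)).comap (LinearMap.fst ℝ U W)) ≤ m)
    (hJ : finrank ℝ ↥(K₀ ⊓ (K₁.map (LinearMap.snd ℝ U W)).comap (LinearMap.snd ℝ U W)) ≤ 2 * m)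
    (hU : finrank ℝ U = a + b + m + f) :
    ∃ (X Y : Submodule ℝ (U × W)) (F : Submodule ℝ U), X ≤ K₁ ∧ Y ≤ K₀ ∧
      finrank ℝ X = a ∧ finrank ℝ Y = b ∧ finrank ℝ F = f ∧
      Disjoint X ((K₀.map (LinearMap.fst ℝ U W)).comap (LinearMap.fst ℝ U W)) ∧
      Disjoint Y ((K₁.map (LinearMap.fst ℝ U W)).comap (LinearMap.fst ℝ U W)) ∧
      Disjoint (X.map (LinearMap.snd ℝ U W)) (Y.map (LinearMap.snd ℝ U W)) ∧
      Disjoint F (X.map (LinearMap.fst ℝ U W) ⊔ K₀.map (LinearMap.fst ℝ U W)) ∧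
      Disjoint F (Y.map (LinearMap.fst ℝ U W) ⊔ K₁.map (LinearMap.fst ℝ U W)) := by
  set p := LinearMap.fst ℝ U W with hp
  set q := LinearMap.snd ℝ U W with hq
  set J := K₀ ⊓ (K₁.map q).comap q with hJdef
  -- Since dim J ≤ 2m, a space Y disjoint from J' meets J in dimension at most m. As the second
  -- projection is injective on K₁, the part of K₁ whose second component lies in that of Y has
  -- dimension at most m too, which leaves room for X of dimension a in K₁.
  obtain ⟨J', hJ'J, hJ', -, -⟩ := exists_le_disjoint_disjoint (min m (finrank ℝ J)) J ⊥ ⊥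
    (by rw [inf_bot_eq, finrank_bot, zero_add]; exact min_le_right _ _)
    (by rw [inf_bot_eq, finrank_bot, zero_add]; exact min_le_right _ _)
  obtain ⟨Y, hYK, hY, hYS, hYJ⟩ := exists_le_disjoint_disjoint b K₀ ((K₁.map p).comap p) J'
    (by lia) (by
      have := Submodule.finrank_mono (inf_le_right : K₀ ⊓ J' ≤ J')
      lia)
  have hYJ2 : finrank ℝ ↥(Y ⊓ J) ≤ m := by
    have h1 := finrank_add_le_of_disjoint (inf_le_right : Y ⊓ J ≤ J) hJ'J
      (hYJ.mono_left inf_le_left)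
    lia
  have hT : finrank ℝ ↥(K₁ ⊓ (Y.map q).comap q) ≤ m := by
    have hinj : Function.Injective (q.domRestrict (K₁ ⊓ (Y.map q).comap q)) := by
      rw [← LinearMap.ker_eq_bot, LinearMap.ker_eq_bot']
      rintro ⟨x, hx⟩ hx0
      exact Subtype.ext (hsnd x hx.1 hx0)
    have h1 : finrank ℝ ↥(K₁ ⊓ (Y.map q).comap q) ≤ finrank ℝ ↥((Y ⊓ J).map q) := by
      rw [← LinearMap.finrank_range_of_inj hinj]
      refine Submodule.finrank_mono ?_
      rintro _ ⟨⟨x, hx1, y, hy, hyx⟩, rfl⟩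
      exact ⟨y, ⟨hy, hYK hy, ⟨x, hx1, hyx.symm⟩⟩, hyx⟩
    exact h1.trans ((Submodule.finrank_map_le q _).trans hYJ2)
  obtain ⟨X, hXK, hX, hXS, hXT⟩ := exists_le_disjoint_disjoint a K₁ ((K₀.map p).comap p)
    ((Y.map q).comap q) (by lia) (by lia)
  have hrank : ∀ A B : Submodule ℝ (U × W), finrank ℝ A + finrank ℝ B + f ≤ finrank ℝ U →
      finrank ℝ ↥(A.map p ⊔ B.map p) + f ≤ finrank ℝ U := by
    intro A B h
    have h1 := Submodule.finrank_add_le_finrank_add_finrank (A.map p) (B.map p)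
    have h2 := Submodule.finrank_map_le p A
    have h3 := Submodule.finrank_map_le p B
    lia
  -- Each of the two sums has dimension at most a + b + m, hence codimension at least f.
  obtain ⟨F, hF, hF1, hF2⟩ := exists_disjoint_disjoint f (X.map p ⊔ K₀.map p)
    (Y.map p ⊔ K₁.map p) (hrank _ _ (by lia)) (hrank _ _ (by lia))
  refine ⟨X, Y, F, hXK, hYK, hX, hY, hF, hXS, hYS, ?_, hF1, hF2⟩
  rw [Submodule.disjoint_def] at hXT ⊢
  rintro _ ⟨x, hx, rfl⟩ hxY
  rw [hXT x hx hxY, map_zero]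

end Alignment

/-- Separability at a receiver with channel maps `g` and `h`: the interference is aligned along
`A`, the other receiver's interference along `O`. -/
theorem eq_zero_of_received_eq_zero {U W Z : Type*} [AddCommGroup U] [Module ℝ U]
    [AddCommGroup W] [Module ℝ W] [AddCommGroup Z] [Module ℝ Z]
    {g : U →ₗ[ℝ] Z} {h : W →ₗ[ℝ] Z} (hg : Function.Injective g) (hh : Function.Injective h)
    {K A O : Submodule ℝ (U × W)} (hK : ∀ p, p ∈ K ↔ g p.1 = h p.2) (hA : A ≤ K)
    (hO : ∀ x ∈ O, x.2 = 0 → x = 0) {F : Submodule ℝ U}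
    (hOK : Disjoint O ((K.map (LinearMap.fst ℝ U W)).comap (LinearMap.fst ℝ U W)))
    (hOA : Disjoint (O.map (LinearMap.snd ℝ U W)) (A.map (LinearMap.snd ℝ U W)))
    (hF : Disjoint F (O.map (LinearMap.fst ℝ U W) ⊔ K.map (LinearMap.fst ℝ U W)))
    {x x' y : U × W} {z : U} (hx : x ∈ O) (hx' : x' ∈ O) (hy : y ∈ A) (hz : z ∈ F)
    (heq : g x.1 + g y.1 + g z + h x'.2 = 0) : x = 0 ∧ x' = 0 ∧ y = 0 ∧ z = 0 := by
  have hyK := (hK y).1 (hA hy)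
  -- The received relation says exactly this, as g y.1 = h y.2. It puts z into the sum avoided by F,
  -- so z = 0; then x.1 is a first component of K, so x = 0; finally x'.2 = -y.2 lies in two
  -- disjoint projections.
  have hmem : (x.1 + z, -x'.2 - y.2) ∈ K := by
    rw [hK]
    simp only [map_add, map_sub, map_neg]
    rw [hyK] at heq
    rw [← sub_eq_zero, ← heq]
    abel
  have hz0 : z = 0 := by
    refine Submodule.disjoint_def.1 hF z hz ?_
    have : z = -x.1 + (x.1 + z) := by abel
    rw [this]
    exact Submodule.add_mem_sup (Submodule.neg_mem _ ⟨x, hx, rfl⟩) ⟨_, hmem, rfl⟩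
  have hx0 : x = 0 := by
    refine Submodule.disjoint_def.1 hOK x hx ⟨_, hmem, ?_⟩
    simp [hz0]
  subst hz0 hx0
  have hsum : x'.2 + y.2 = 0 := by
    apply hh
    rw [map_add, map_zero, ← heq, hyK]
    simp [add_comm]
  have hx'2 : x'.2 = 0 := by
    refine Submodule.disjoint_def.1 hOA _ ⟨x', hx', rfl⟩ ⟨-y, A.neg_mem hy, ?_⟩
    exact (eq_neg_of_add_eq_zero_left hsum).symm
  have hy2 : y.2 = 0 := by rwa [hx'2, zero_add] at hsum
  have hy1 : y.1 = 0 := hg (by rw [hyK, hy2, map_zero, map_zero])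
  exact ⟨rfl, hO x' hx' hx'2, Prod.ext hy1 hy2, rfl⟩

/-! ### The interference alignment precoder -/

/-- The lengths of the four message blocks. -/
def blockLength (a b f : ℕ) : Fin 2 → Fin 2 → ℕ
  | 0, _ => a
  | 1, 0 => b + f
  | 1, 1 => b

/-- The number of aligned pairs of symbols. -/
def alignedLength (a b : ℕ) : Fin 2 → ℕ
  | 0 => a
  | 1 => b

/-- The precoder built from a list of pairs aligned at the second receiver, a list of pairs aligned
at the first receiver, and a list of further vectors of the first transmitter. -/
def pairPrecoder {a b f : ℕ} (x : Fin a → (Fin (M 0) → ℂ) × (Fin (M 1) → ℂ))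
    (y : Fin b → (Fin (M 0) → ℂ) × (Fin (M 1) → ℂ)) (z : Fin f → Fin (M 0) → ℂ) :
    Precoder M (blockLength a b f)
  | 0, 0 => fun i => (x i).1
  | 0, 1 => fun i => (x i).2
  | 1, 0 => Fin.append (fun i => (y i).1) z
  | 1, 1 => fun i => (y i).2

/-- The pairs of transmit signals that arrive at receiver `r` aligned. -/
def alignedSpace (H : Channel M N) (r : Fin 2) :
    Submodule ℝ ((Fin (M 0) → ℂ) × (Fin (M 1) → ℂ)) :=
  LinearMap.ker (link M N r 0 H ∘ₗ LinearMap.fst ℝ _ _ - link M N r 1 H ∘ₗ LinearMap.snd ℝ (Fin (M 0) → ℂ) (Fin (M 1) → ℂ))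

theorem mem_alignedSpace (H : Channel M N) (r : Fin 2)
    (p : (Fin (M 0) → ℂ) × (Fin (M 1) → ℂ)) :
    p ∈ alignedSpace H r ↔ link M N r 0 H p.1 = link M N r 1 H p.2 := by
  rw [alignedSpace, LinearMap.mem_ker, LinearMap.sub_apply, sub_eq_zero]
  rfl

theorem finrank_complex_vector (m : ℕ) : Module.finrank ℝ (Fin m → ℂ) = 2 * m := by
  simp [Module.finrank_pi_fintype, Complex.finrank_real_complex, mul_comm]

theorem finrank_ker_sharedLink_add (t : Fin 2) (H : Channel M N) :
    Module.finrank ℝ (LinearMap.range (sharedLink M N t H)) +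
      Module.finrank ℝ (LinearMap.ker (sharedLink M N t H)) = 2 * M t + 2 * (2 * M t.rev) := by
  rw [LinearMap.finrank_range_add_finrank_ker, Module.finrank_prod,
    Module.finrank_pi_fintype ℝ (M := fun _ : Fin 2 => Fin (M t.rev) → ℂ), Fin.sum_univ_two,
    finrank_complex_vector, finrank_complex_vector]
  ring

theorem finrank_receivers :
    Module.finrank ℝ (∀ r, Fin (N r) → ℂ) = 2 * (N 0 + N 1) := by
  rw [Module.finrank_pi_fintype]
  simp only [finrank_complex_vector, Fin.sum_univ_two]
  ring

/-- Targets supported at r show that (u, w) ↦ H r 0 u - H r 1 w is onto; rank-nullity gives the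
dimension of its kernel. -/
theorem finrank_alignedSpace {H : Channel M N} (h : Function.Surjective (sharedLink M N 1 H))
    (r : Fin 2) :
    2 * N r + Module.finrank ℝ (alignedSpace H r) = 2 * M 0 + 2 * M 1 := by
  have hsurj : Function.Surjective
      (link M N r 0 H ∘ₗ LinearMap.fst ℝ (Fin (M 0) → ℂ) (Fin (M 1) → ℂ) -
        link M N r 1 H ∘ₗ LinearMap.snd ℝ (Fin (M 0) → ℂ) (Fin (M 1) → ℂ)) := by
    intro y
    obtain ⟨p, hp⟩ := h (Pi.single r y)
    have hr := congrFun hp r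
    rw [Pi.single_eq_same] at hr
    refine ⟨(p.2 r, -p.1), ?_⟩
    rw [← hr]
    simp only [LinearMap.sub_apply, LinearMap.comp_apply, LinearMap.fst_apply,
      LinearMap.snd_apply, map_neg, sub_neg_eq_add]
    exact add_comm _ _
  have h1 := LinearMap.finrank_range_add_finrank_ker
    (link M N r 0 H ∘ₗ LinearMap.fst ℝ (Fin (M 0) → ℂ) (Fin (M 1) → ℂ) -
        link M N r 1 H ∘ₗ LinearMap.snd ℝ (Fin (M 0) → ℂ) (Fin (M 1) → ℂ))
  rw [LinearMap.range_eq_top.2 hsurj, finrank_top, Module.finrank_prod] at h1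
  simp only [finrank_complex_vector] at h1
  exact h1

/-- A first component u shared by pairs aligned at either receiver is a signal of transmitter 0 that
transmitter 1 can cancel with a separate signal at each receiver, that is, an element of the kernel.
-/
theorem finrank_inf_comap_fst_le (H : Channel M N) (r : Fin 2) :
    Module.finrank ℝ ↥(alignedSpace H r ⊓ ((alignedSpace H r.rev).map
      (LinearMap.fst ℝ (Fin (M 0) → ℂ) (Fin (M 1) → ℂ))).comap (LinearMap.fst ℝ _ _)) ≤
      Module.finrank ℝ (LinearMap.ker (sharedLink M N 0 H)) := by
  refine le_trans (Submodule.finrank_mono (t := (LinearMap.ker (sharedLink M N 0 H)).map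
    ((LinearMap.fst ℝ (Fin (M 0) → ℂ) (Fin 2 → Fin (M 1) → ℂ)).prod
      (-(LinearMap.proj r ∘ₗ LinearMap.snd ℝ (Fin (M 0) → ℂ) (Fin 2 → Fin (M 1) → ℂ))))) ?_)
    (Submodule.finrank_map_le _ _)
  rintro ⟨u, w⟩ ⟨h1, ⟨u', w'⟩, h2, h3⟩
  have h3 : u' = u := h3
  subst h3
  have hne : r.rev ≠ r := by fin_cases r <;> simp
  have h1 : H.mat r 0 *ᵥ u' = H.mat r 1 *ᵥ w := (mem_alignedSpace H r _).1 h1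
  have h2 : H.mat r.rev 0 *ᵥ u' = H.mat r.rev 1 *ᵥ w' := (mem_alignedSpace H r.rev _).1 h2
  refine ⟨(u', fun s => if s = r then -w else -w'), ?_, ?_⟩
  · refine LinearMap.mem_ker.2 (funext fun s => ?_)
    rw [sharedLink_apply]
    rcases (by fin_cases r <;> fin_cases s <;> simp : s = r ∨ s = r.rev) with rfl | rfl
    · change H.mat s 0 *ᵥ u' + H.mat s 1 *ᵥ (if s = s then -w else -w') = 0
      rw [if_pos rfl, h1, Matrix.mulVec_neg, add_neg_cancel]
    · change H.mat r.rev 0 *ᵥ u' + H.mat r.rev 1 *ᵥ (if r.rev = r then -w else -w') = 0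
      rw [if_neg hne, h2, Matrix.mulVec_neg, add_neg_cancel]
  · simp

/-- The same correspondence with the transmitters exchanged. -/
theorem finrank_inf_comap_snd_le (H : Channel M N) :
    Module.finrank ℝ ↥(alignedSpace H 0 ⊓ ((alignedSpace H 1).map
      (LinearMap.snd ℝ (Fin (M 0) → ℂ) (Fin (M 1) → ℂ))).comap (LinearMap.snd ℝ _ _)) ≤
      Module.finrank ℝ (LinearMap.ker (sharedLink M N 1 H)) := by
  refine le_trans (Submodule.finrank_mono (t := (LinearMap.ker (sharedLink M N 1 H)).map
    ((-(LinearMap.proj 0 ∘ₗ LinearMap.snd ℝ (Fin (M 1) → ℂ) (Fin 2 → Fin (M 0) → ℂ))).prod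
      (LinearMap.fst ℝ (Fin (M 1) → ℂ) (Fin 2 → Fin (M 0) → ℂ)))) ?_)
    (Submodule.finrank_map_le _ _)
  rintro ⟨u, w⟩ ⟨h1, ⟨u', w'⟩, h2, h3⟩
  have h3 : w' = w := h3
  subst h3
  have h1 : H.mat 0 0 *ᵥ u = H.mat 0 1 *ᵥ w' := (mem_alignedSpace H 0 _).1 h1
  have h2 : H.mat 1 0 *ᵥ u' = H.mat 1 1 *ᵥ w' := (mem_alignedSpace H 1 _).1 h2
  refine ⟨(w', ![-u, -u']), ?_, ?_⟩
  · refine LinearMap.mem_ker.2 (funext (Fin.forall_fin_two.2 ⟨?_, ?_⟩))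
    · change H.mat 0 1 *ᵥ w' + H.mat 0 0 *ᵥ (-u) = 0
      rw [h1.symm, Matrix.mulVec_neg, add_neg_cancel]
    · change H.mat 1 1 *ᵥ w' + H.mat 1 0 *ᵥ (-u') = 0
      rw [h2.symm, Matrix.mulVec_neg, add_neg_cancel]
  · simp

theorem sum_smul_mem_eq_zero {V : Type*} [AddCommGroup V] [Module ℝ V] {n : ℕ}
    {S : Submodule ℝ V} (e : Module.Basis (Fin n) ℝ S) (c : Fin n → ℝ)
    (h : ∑ i, c i • (e i : V) = 0) : c = 0 := by
  have h1 : LinearIndependent ℝ fun i => (e i : V) :=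
    e.linearIndependent.map' S.subtype (Submodule.ker_subtype S)
  exact funext (Fintype.linearIndependent_iff.1 h1 c h)

/-- Almost every channel has an interference alignment precoder. -/
theorem ae_exists_isAligned {a b f m : ℕ} (hN : N 1 ≤ N 0) (hNM : M 0 ≤ N 1) (hM : M 1 ≤ M 0)
    (ha : a + N 1 = N 0 + M 1) (hb : b + N 0 = N 1 + M 1) (hf : f + 3 * M 1 = N 0 + N 1)
    (hm : m + N 0 + N 1 = 2 * M 0 + M 1) {v : Fin 2 → Fin 2 → ℝ≥0} (hv : ∀ r t, v r t ≠ 0) :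
    ∀ᵐ H ∂(channelLaw M N v), (∀ r t, Function.Injective (link M N r t H)) ∧
      ∃ V : Precoder M (blockLength a b f), IsAligned H V (alignedLength a b) := by
  have hMN : ∀ r t, M t ≤ N r := by
    refine Fin.forall_fin_two.2 ⟨Fin.forall_fin_two.2 ⟨?_, ?_⟩, Fin.forall_fin_two.2 ⟨?_, ?_⟩⟩ <;>
      lia
  have hinj : ∀ᵐ H ∂(channelLaw M N v), ∀ r t, Function.Injective (link M N r t H) := by
    simp only [ae_all_iff]
    exact fun r t => ae_link_injective hv (hMN r t)
  have hr1 : (1 : Fin 2).rev = 0 := rfl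
  have hsurj : ∀ᵐ H ∂(channelLaw M N v), Function.Surjective (sharedLink M N 1 H) :=
    ae_sharedLink_surjective hv (fun r => hMN r _) (by rw [hr1]; lia)
  -- When the map is onto, its kernel has real dimension 2 (M 0 + 2 M 1 - N 0 - N 1), which is at
  -- most m exactly when 3 M 1 ≤ N 0 + N 1. When it is injective there is no kernel.
  have hker : ∀ᵐ H ∂(channelLaw M N v),
      Module.finrank ℝ (LinearMap.ker (sharedLink M N 0 H)) ≤ m := by
    rcases le_total (N 0 + N 1) (2 * M 1 + M 0) with h | h
    · filter_upwards [ae_sharedLink_surjective (t := 0) hv (fun r => hMN r _) h] with H hH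
      have h1 := finrank_ker_sharedLink_add 0 H
      rw [LinearMap.range_eq_top.2 hH, finrank_top, finrank_receivers] at h1
      have h2 : M (Fin.rev 0) = M 1 := rfl
      lia
    · filter_upwards [ae_sharedLink_injective (t := 0) hv (fun r => hMN r _) h] with H hH
      rw [LinearMap.ker_eq_bot.2 hH, finrank_bot]
      exact Nat.zero_le m
  filter_upwards [hinj, hsurj, hker] with H hinj hsurj hker
  refine ⟨hinj, ?_⟩
  have hK0 := finrank_alignedSpace hsurj 0
  have hK1 := finrank_alignedSpace hsurj 1
  have hker1 := finrank_ker_sharedLink_add 1 H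
  rw [LinearMap.range_eq_top.2 hsurj, finrank_top, finrank_receivers] at hker1
  have hM0 : M (Fin.rev 1) = M 0 := rfl
  have hsnd : ∀ r, ∀ x ∈ alignedSpace H r, x.2 = 0 → x = 0 := by
    intro r x hx hx2
    rw [mem_alignedSpace, hx2, map_zero] at hx
    exact Prod.ext (hinj r 0 (by rw [hx, Prod.fst_zero, map_zero])) hx2
  -- The dimensions fit: 2 (M 0 + M 1 - N 0) = b + m, 2 (M 0 + M 1 - N 1) = a + m, the kernel of
  -- `sharedLink M N 1 H` has dimension 2m, and 2 M 0 = a + b + m + f.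
  obtain ⟨X, Y, F, hXK, hYK, hX, hY, hF, hXS, hYS, hXY, hFX, hFY⟩ :=
    exists_alignment_subspaces (a := a) (b := b) (f := f) (m := m)
      (K₀ := alignedSpace H 0) (K₁ := alignedSpace H 1) (by lia) (by lia) (hsnd 1)
      ((finrank_inf_comap_fst_le H 0).trans hker) ((finrank_inf_comap_fst_le H 1).trans hker)
      ((finrank_inf_comap_snd_le H).trans (by lia)) (by rw [finrank_complex_vector]; lia)
  set x := Module.finBasisOfFinrankEq ℝ X hX
  set y := Module.finBasisOfFinrankEq ℝ Y hY
  set z := Module.finBasisOfFinrankEq ℝ F hF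
  -- Both transmitters use the same basis of pairs but independent coefficients. The vectors of F
  -- are interference at receiver 0 and desired at receiver 1; separability treats both alike.
  have h0 : ∀ (c c' : Fin a → ℝ) (d : Fin b → ℝ) (e : Fin f → ℝ),
      link M N 0 0 H (∑ i, c i • (x i).1.1) + link M N 0 0 H (∑ i, d i • (y i).1.1) +
        link M N 0 0 H (∑ i, e i • (z i).1) + link M N 0 1 H (∑ i, c' i • (x i).1.2) = 0 →
      c = 0 ∧ c' = 0 ∧ d = 0 ∧ e = 0 := by
    intro c c' d e h
    have := eq_zero_of_received_eq_zero (hinj 0 0) (hinj 0 1) (mem_alignedSpace H 0) hYK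
      (fun p hp => hsnd 1 p (hXK hp)) hXS hXY hFX
      (x := ∑ i, c i • (x i).1) (x' := ∑ i, c' i • (x i).1) (y := ∑ i, d i • (y i).1)
      (z := ∑ i, e i • (z i).1)
      (X.sum_mem fun i _ => X.smul_mem _ (x i).2) (X.sum_mem fun i _ => X.smul_mem _ (x i).2)
      (Y.sum_mem fun i _ => Y.smul_mem _ (y i).2) (F.sum_mem fun i _ => F.smul_mem _ (z i).2)
      (by simpa only [Prod.fst_sum, Prod.snd_sum, Prod.smul_fst, Prod.smul_snd] using h)
    exact ⟨sum_smul_mem_eq_zero x c this.1, sum_smul_mem_eq_zero x c' this.2.1,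
      sum_smul_mem_eq_zero y d this.2.2.1, sum_smul_mem_eq_zero z e this.2.2.2⟩
  have h1 : ∀ (c : Fin a → ℝ) (d d' : Fin b → ℝ) (e : Fin f → ℝ),
      link M N 1 0 H (∑ i, d i • (y i).1.1) + link M N 1 0 H (∑ i, c i • (x i).1.1) +
        link M N 1 0 H (∑ i, e i • (z i).1) + link M N 1 1 H (∑ i, d' i • (y i).1.2) = 0 →
      c = 0 ∧ d = 0 ∧ d' = 0 ∧ e = 0 := by
    intro c d d' e h
    have := eq_zero_of_received_eq_zero (hinj 1 0) (hinj 1 1) (mem_alignedSpace H 1) hXK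
      (fun p hp => hsnd 0 p (hYK hp)) hYS hXY.symm hFY
      (x := ∑ i, d i • (y i).1) (x' := ∑ i, d' i • (y i).1) (y := ∑ i, c i • (x i).1)
      (z := ∑ i, e i • (z i).1)
      (Y.sum_mem fun i _ => Y.smul_mem _ (y i).2) (Y.sum_mem fun i _ => Y.smul_mem _ (y i).2)
      (X.sum_mem fun i _ => X.smul_mem _ (x i).2) (F.sum_mem fun i _ => F.smul_mem _ (z i).2)
      (by simpa only [Prod.fst_sum, Prod.snd_sum, Prod.smul_fst, Prod.smul_snd] using h)
    exact ⟨sum_smul_mem_eq_zero x c this.2.2.1, sum_smul_mem_eq_zero y d this.1,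
      sum_smul_mem_eq_zero y d' this.2.1, sum_smul_mem_eq_zero z e this.2.2.2⟩
  refine ⟨pairPrecoder (fun i => (x i).1) (fun i => (y i).1) fun i => (z i).1, ?_, ?_, ?_⟩
  · refine Fin.forall_fin_two.2 ⟨Fin.forall_fin_two.2 ⟨le_rfl, le_rfl⟩,
      Fin.forall_fin_two.2 ⟨Nat.le_add_right b f, le_rfl⟩⟩
  · refine Fin.forall_fin_two.2 ⟨fun i => ?_, fun i => ?_⟩
    · have h2 := (mem_alignedSpace H 0 _).1 (hYK (y i).2)
      refine Eq.trans (congrArg (link M N 0 0 H) ?_) h2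
      exact Fin.append_left (fun i => (y i).1.1) (fun i => (z i).1) i
    · exact (mem_alignedSpace H 1 _).1 (hXK (x i).2)
  · refine Fin.forall_fin_two.2 ⟨?_, ?_⟩
    · rw [Fintype.linearIndependent_iff]
      intro g hg
      -- All symbols of transmitter 1 for the other receiver are aligned, so no unaligned ones
      -- remain.
      have hempty : IsEmpty {i : Fin (blockLength a b f (Fin.rev 0) 1) //
          alignedLength a b (Fin.rev 0) ≤ (i : ℕ)} := ⟨fun i => absurd i.2 (not_le.2 i.1.2)⟩
      rw [Fintype.sum_sum_type, Fintype.sum_sum_type, Fintype.sum_sigma, Fin.sum_univ_two,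
        Fintype.sum_empty (fun i : {i : Fin (blockLength a b f (Fin.rev 0) 1) //
          alignedLength a b (Fin.rev 0) ≤ (i : ℕ)} => _), add_zero] at hg
      have hg' : (∑ i : Fin a, g (Sum.inl ⟨0, i⟩) • link M N 0 0 H (x i).1.1 +
          ∑ i : Fin a, g (Sum.inl ⟨1, i⟩) • link M N 0 1 H (x i).1.2) +
          ∑ i : Fin (b + f), g (Sum.inr (Sum.inl i)) • link M N 0 0 H
            (Fin.append (fun i => (y i).1.1) (fun i => (z i).1) i) = 0 := hg
      rw [Fin.sum_univ_add] at hg'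
      simp only [Fin.append_left, Fin.append_right] at hg'
      obtain ⟨e1, e2, e3, e4⟩ := h0 (fun i => g (Sum.inl ⟨0, i⟩)) (fun i => g (Sum.inl ⟨1, i⟩))
        (fun i => g (Sum.inr (Sum.inl (Fin.castAdd f i))))
        (fun i => g (Sum.inr (Sum.inl (Fin.natAdd b i)))) (by
          simp only [map_sum, map_smul]
          rw [← hg']
          abel)
      rintro (⟨t, i⟩ | i | i)
      · match t, i with
        | 0, i => exact congrFun e1 i
        | 1, i => exact congrFun e2 i
      · exact Fin.addCases (motive := fun i : Fin (b + f) => g (Sum.inr (Sum.inl i)) = 0)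
          (fun i => congrFun e3 i) (fun i => congrFun e4 i) i
      · exact hempty.elim i
    · rw [Fintype.linearIndependent_iff]
      intro g hg
      have hempty : IsEmpty {i : Fin (blockLength a b f (Fin.rev 1) 1) //
          alignedLength a b (Fin.rev 1) ≤ (i : ℕ)} := ⟨fun i => absurd i.2 (not_le.2 i.1.2)⟩
      rw [Fintype.sum_sum_type, Fintype.sum_sum_type, Fintype.sum_sigma, Fin.sum_univ_two,
        Fintype.sum_empty (fun i : {i : Fin (blockLength a b f (Fin.rev 1) 1) //
          alignedLength a b (Fin.rev 1) ≤ (i : ℕ)} => _), add_zero] at hg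
      have hg' : (∑ i : Fin (b + f), g (Sum.inl ⟨0, i⟩) • link M N 1 0 H
            (Fin.append (fun i => (y i).1.1) (fun i => (z i).1) i) +
          ∑ i : Fin b, g (Sum.inl ⟨1, i⟩) • link M N 1 1 H (y i).1.2) +
          ∑ i : Fin a, g (Sum.inr (Sum.inl i)) • link M N 1 0 H (x i).1.1 = 0 := hg
      rw [Fin.sum_univ_add] at hg'
      simp only [Fin.append_left, Fin.append_right] at hg'
      obtain ⟨e1, e2, e3, e4⟩ := h1 (fun i => g (Sum.inr (Sum.inl i)))
        (fun i => g (Sum.inl ⟨0, Fin.castAdd f i⟩)) (fun i => g (Sum.inl ⟨1, i⟩))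
        (fun i => g (Sum.inl ⟨0, Fin.natAdd b i⟩)) (by
          simp only [map_sum, map_smul]
          rw [← hg']
          abel)
      rintro (⟨t, i⟩ | i | i)
      · match t, i with
        | 0, i =>
          exact Fin.addCases (motive := fun i : Fin (b + f) => g (Sum.inl ⟨0, i⟩) = 0)
            (fun i => congrFun e2 i) (fun i => congrFun e4 i) i
        | 1, i => exact congrFun e3 i
      · exact congrFun e1 i
      · exact hempty.elim i

/-! ### Zero forcing -/

theorem exists_dual_family {ι E : Type*} [AddCommGroup E] [Module ℝ E] [DecidableEq ι] {b : ι → E}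
    (hb : LinearIndependent ℝ b) :
    ∃ φ : ι → E →ₗ[ℝ] ℝ, ∀ i j, φ i (b j) = if j = i then 1 else 0 := by
  obtain ⟨g, hg⟩ := (Finsupp.linearCombination ℝ b).exists_leftInverse_of_injective
    (LinearMap.ker_eq_bot.2 hb)
  refine ⟨fun i => Finsupp.lapply i ∘ₗ g, fun i j => ?_⟩
  have h := LinearMap.congr_fun hg (Finsupp.single j 1)
  rw [LinearMap.comp_apply, Finsupp.linearCombination_single, one_smul] at h
  simp [h, Finsupp.single_apply]

/-- With an aligned precoder, each receiver can recover each of its symbols by a linear functional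
that suppresses all other symbols. -/
theorem IsAligned.exists_zeroForcing {H : Channel M N} {Q : Fin 2 → Fin 2 → ℕ}
    {V : Precoder M Q} {A : Fin 2 → ℕ} (h : IsAligned H V A) :
    ∃ φ : ∀ r t : Fin 2, Fin (Q r t) → (Fin (N r) → ℂ) →ₗ[ℝ] ℝ,
      (∀ r t i t' i', φ r t i (H.mat r t' *ᵥ V r t' i') =
        if (⟨t', i'⟩ : Σ t : Fin 2, Fin (Q r t)) = ⟨t, i⟩ then 1 else 0) ∧
      ∀ r t i t' i', φ r t i (H.mat r t' *ᵥ V r.rev t' i') = 0 := by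
  classical
  choose φ hφ using fun r => exists_dual_family (h.independent r)
  refine ⟨fun r t i => φ r (Sum.inl ⟨t, i⟩), fun r t i t' i' => ?_, fun r t i t' i' => ?_⟩
  · have := hφ r (Sum.inl ⟨t, i⟩) (Sum.inl ⟨t', i'⟩)
    simpa only [Sum.elim_inl, Sum.inl.injEq] using this
  · have h0 : ∀ i', φ r (Sum.inl ⟨t, i⟩) (H.mat r 0 *ᵥ V r.rev 0 i') = 0 := fun i' => by
      simpa using hφ r (Sum.inl ⟨t, i⟩) (Sum.inr (Sum.inl i'))
    match t', i' with
    | 0, i' => exact h0 i'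
    | 1, i' =>
      by_cases hi : A r.rev ≤ (i' : ℕ)
      · simpa using hφ r (Sum.inl ⟨t, i⟩) (Sum.inr (Sum.inr ⟨i', hi⟩))
      · have hal := h.aligned r ⟨i', not_le.1 hi⟩
        have hcast : Fin.castLE (h.le_length r.rev 1) ⟨i', not_le.1 hi⟩ = i' := rfl
        rw [hcast] at hal
        rw [← hal]
        exact h0 _

theorem exists_sq_le_energy {m : ℕ} (φ : (Fin m → ℂ) →ₗ[ℝ] ℝ) :
    ∃ L : ℝ, 0 ≤ L ∧ ∀ z, φ z ^ 2 ≤ L * ∑ j, ‖z j‖ ^ 2 := by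
  set φ' := LinearMap.toContinuousLinearMap φ
  refine ⟨‖φ'‖ ^ 2, by positivity, fun z => ?_⟩
  have h1 : ‖φ' z‖ ≤ ‖φ'‖ * ‖z‖ := φ'.le_opNorm z
  have h2 : ‖z‖ ^ 2 ≤ ∑ j, ‖z j‖ ^ 2 := by
    have h3 : ‖z‖ ≤ √(∑ j, ‖z j‖ ^ 2) := by
      refine (pi_norm_le_iff_of_nonneg (Real.sqrt_nonneg _)).2 fun j => Real.le_sqrt_of_sq_le ?_
      exact Finset.single_le_sum (f := fun j => ‖z j‖ ^ 2) (fun j _ => by positivity)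
        (Finset.mem_univ j)
    calc ‖z‖ ^ 2 ≤ √(∑ j, ‖z j‖ ^ 2) ^ 2 := by gcongr
      _ = _ := Real.sq_sqrt (by positivity)
  calc φ z ^ 2 = ‖φ' z‖ ^ 2 := by simp [φ']
    _ ≤ (‖φ'‖ * ‖z‖) ^ 2 := by gcongr
    _ = ‖φ'‖ ^ 2 * ‖z‖ ^ 2 := mul_pow _ _ _
    _ ≤ _ := by gcongr

/-! ### The Gilbert–Varshamov bound -/

/-- A word of the ball is given by a set of at most d positions and the letters there. Bounding the
number of sets by 2 ^ n costs only one bit of rate. -/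
theorem card_hamming_ball_le {n q d : ℕ} (hq : 1 ≤ q) (c : Fin n → Fin q) :
    (Finset.univ.filter fun y => hammingDist c y ≤ d).card ≤ 2 ^ n * q ^ d := by
  classical
  set T : Finset (Finset (Fin n)) := Finset.univ.filter fun S => S.card ≤ d with hT
  have hsub : (Finset.univ.filter fun y => hammingDist c y ≤ d) ⊆
      T.biUnion fun S => Fintype.piFinset fun i => if i ∈ S then Finset.univ else {c i} := by
    intro y hy
    rw [Finset.mem_biUnion]
    refine ⟨Finset.univ.filter fun i => c i ≠ y i, ?_, ?_⟩
    · simpa [hT, hammingDist] using hy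
    · rw [Fintype.mem_piFinset]
      intro i
      by_cases h : c i = y i <;> simp [h]
  calc _ ≤ _ := Finset.card_le_card hsub
    _ ≤ ∑ S ∈ T, (Fintype.piFinset fun i => if i ∈ S then Finset.univ else {c i}).card :=
      Finset.card_biUnion_le
    _ ≤ ∑ _S ∈ T, q ^ d := by
      refine Finset.sum_le_sum fun S hS => ?_
      rw [Fintype.card_piFinset]
      have : ∀ i, (if i ∈ S then (Finset.univ : Finset (Fin q)) else {c i}).card =
          if i ∈ S then q else 1 := by
        intro i; split_ifs <;> simp
      rw [Finset.prod_congr rfl fun i _ => this i, Finset.prod_ite_mem, Finset.univ_inter,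
        Finset.prod_const]
      exact Nat.pow_le_pow_right hq (Finset.mem_filter.1 hS).2
    _ ≤ 2 ^ n * q ^ d := by
      rw [Finset.sum_const, smul_eq_mul]
      gcongr
      calc T.card ≤ (Finset.univ : Finset (Finset (Fin n))).card := Finset.card_filter_le _ _
        _ = 2 ^ n := by simp

/-- There are large codes of prescribed minimum distance. -/
theorem exists_code_hammingDist (n q d : ℕ) (hq : 1 ≤ q) :
    ∃ (K : ℕ) (C : Fin K → Fin n → Fin q), (∀ i j, i ≠ j → d < hammingDist (C i) (C j)) ∧
      q ^ n ≤ K * (2 ^ n * q ^ d) := by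
  classical
  set P : Finset (Finset (Fin n → Fin q)) := Finset.univ.filter fun S =>
    ∀ x ∈ S, ∀ y ∈ S, x ≠ y → d < hammingDist x y with hP
  -- For a code of maximal size the balls of radius d cover everything, since an uncovered word
  -- could be added.
  obtain ⟨S, hS, hmax⟩ := P.exists_max_image Finset.card ⟨∅, by simp [hP]⟩
  have hSP := (Finset.mem_filter.1 hS).2
  have hcover : (Finset.univ : Finset (Fin n → Fin q)) ⊆
      S.biUnion fun c => Finset.univ.filter fun y => hammingDist c y ≤ d := by
    intro y _
    by_contra hy
    simp only [Finset.mem_biUnion, Finset.mem_filter, Finset.mem_univ, true_and, not_exists,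
      not_and, not_le] at hy
    have hyS : y ∉ S := fun h => by simpa using hy y h
    have hins : insert y S ∈ P := by
      refine Finset.mem_filter.2 ⟨Finset.mem_univ _, fun x hx z hz hxz => ?_⟩
      rcases Finset.mem_insert.1 hx with hx' | hx' <;>
        rcases Finset.mem_insert.1 hz with hz' | hz'
      · exact absurd (hx'.trans hz'.symm) hxz
      · rw [hx', hammingDist_comm]; exact hy z hz'
      · rw [hz']; exact hy x hx'
      · exact hSP x hx' z hz' hxz
    have := hmax _ hins
    rw [Finset.card_insert_of_notMem hyS] at this
    lia
  refine ⟨S.card, fun i => S.equivFin.symm i, fun i j hij => ?_, ?_⟩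
  · refine hSP _ (Subtype.prop _) _ (Subtype.prop _) fun h => hij ?_
    exact S.equivFin.symm.injective (Subtype.ext h)
  · calc q ^ n = (Finset.univ : Finset (Fin n → Fin q)).card := by simp
      _ ≤ _ := Finset.card_le_card hcover
      _ ≤ ∑ c ∈ S, (Finset.univ.filter fun y => hammingDist c y ≤ d).card :=
        Finset.card_biUnion_le
      _ ≤ ∑ _c ∈ S, 2 ^ n * q ^ d := Finset.sum_le_sum fun c _ => card_hamming_ball_le hq c
      _ = _ := by rw [Finset.sum_const, smul_eq_mul]

/-- Decoding of a word to a codeword within Hamming distance `e`. -/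
def hammingDecode {n q K : ℕ} (hK : 0 < K) (C : Fin K → Fin n → Fin q) (e : ℕ)
    (y : Fin n → Fin q) : Fin K :=
  open Classical in if h : ∃ i, hammingDist (C i) y ≤ e then h.choose else ⟨0, hK⟩

/-- Two codewords within e of y would be within 2e of each other. -/
theorem hammingDecode_eq {n q K : ℕ} (hK : 0 < K) {C : Fin K → Fin n → Fin q} {e : ℕ}
    (hC : ∀ i j, i ≠ j → 2 * e < hammingDist (C i) (C j)) {i : Fin K} {y : Fin n → Fin q}
    (h : hammingDist (C i) y ≤ e) : hammingDecode hK C e y = i := by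
  have hex : ∃ i, hammingDist (C i) y ≤ e := ⟨i, h⟩
  rw [hammingDecode, dif_pos hex]
  by_contra hne
  have h1 := hC _ _ hne
  have h2 := hammingDist_triangle (C hex.choose) y (C i)
  have h3 := hex.choose_spec
  rw [hammingDist_comm y] at h2
  lia

/-! ### Pulse amplitude modulation -/

/-- The index of the constellation point nearest to `x`. -/
def quantize {q : ℕ} (hq : 0 < q) (x : ℝ) : Fin q :=
  ⟨min ⌊x + 1 / 2⌋₊ (q - 1), by lia⟩

theorem measurable_quantize {q : ℕ} (hq : 0 < q) : Measurable (quantize hq) := by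
  have h : Measurable fun k : ℕ => (⟨min k (q - 1), by lia⟩ : Fin q) := Measurable.of_discrete
  exact h.comp (Nat.measurable_floor.comp (measurable_id.add_const _))

theorem quantize_eq {q : ℕ} (hq : 0 < q) {j : Fin q} {x : ℝ} (h : |x - (j : ℕ)| < 1 / 2) :
    quantize hq x = j := by
  rw [abs_lt] at h
  have hfloor : ⌊x + 1 / 2⌋₊ = (j : ℕ) := by
    rw [Nat.floor_eq_iff (by have : (0 : ℝ) ≤ (j : ℕ) := Nat.cast_nonneg _; linarith)]
    constructor <;> linarith
  refine Fin.ext ?_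
  change min ⌊x + 1 / 2⌋₊ (q - 1) = j
  rw [hfloor]
  have := j.2
  lia

/-- The total noise energy exceeds its mean by more than a constant factor only with exponentially
small probability. -/
theorem noiseLaw_energy_gt_le (N : Fin 2 → ℕ) (n : ℕ) (r : Fin 2) :
    (noiseLaw N n r).real {z | (2 * (N 0 + N 1 + 1) : ℝ) * n < energy z} ≤ Real.exp (-n) := by
  set c : ℝ := 2 * (N 0 + N 1 + 1) with hc
  have hNr : (N r : ℝ) ≤ N 0 + N 1 := by
    have h0 : (0 : ℝ) ≤ N 0 := Nat.cast_nonneg _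
    have h1 : (0 : ℝ) ≤ N 1 := Nat.cast_nonneg _
    revert r
    exact Fin.forall_fin_two.2 ⟨by linarith, by linarith⟩
  -- Each coordinate contributes E exp(|z|²/2) = 2. Markov's inequality and 2 ≤ exp 1 then leave
  -- exp(-n), because c / 2 ≥ N r + 1.
  have hmom : ∫⁻ z, ENNReal.ofReal (Real.exp (energy z / 2)) ∂(noiseLaw N n r) =
      2 ^ (n * N r) := by
    rw [noiseLaw_eq_blockLaw, blockLaw_eq_withDensity n (N r) one_ne_zero,
      lintegral_withDensity_eq_lintegral_mul _ (by fun_prop) (by fun_prop)]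
    have hpt : ∀ z : Fin n → Fin (N r) → ℂ,
        ENNReal.ofReal ((Real.pi * (1 : ℝ≥0))⁻¹ ^ (n * N r) *
          Real.exp (-(energy z / (1 : ℝ≥0)))) * ENNReal.ofReal (Real.exp (energy z / 2)) =
        ENNReal.ofReal (Real.pi⁻¹ ^ (n * N r)) *
          ENNReal.ofReal (Real.exp (-(1 / 2 * energy z))) := by
      intro z
      rw [← ENNReal.ofReal_mul (by positivity), ← ENNReal.ofReal_mul (by positivity), mul_assoc,
        ← Real.exp_add, NNReal.coe_one, mul_one, div_one]
      congr 3
      ring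
    simp only [Pi.mul_apply, hpt]
    rw [lintegral_const_mul _ (by fun_prop), lintegral_exp_neg_mul_energy n (N r) (by norm_num),
      ← ENNReal.ofReal_pow (by positivity), ← ENNReal.ofReal_mul (by positivity), ← mul_pow]
    have : Real.pi⁻¹ * (Real.pi / (1 / 2)) = 2 := by
      have := Real.pi_pos.ne'
      field_simp
    rw [this, ENNReal.ofReal_pow (by norm_num)]
    simp
  have hmarkov := mul_meas_ge_le_lintegral (μ := noiseLaw N n r)
    (f := fun z => ENNReal.ofReal (Real.exp (energy z / 2))) (by fun_prop)
    (ENNReal.ofReal (Real.exp (c * n / 2)))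
  rw [hmom] at hmarkov
  have hsub : {z : Fin n → Fin (N r) → ℂ | c * n < energy z} ⊆
      {z | ENNReal.ofReal (Real.exp (c * n / 2)) ≤ ENNReal.ofReal (Real.exp (energy z / 2))} := by
    intro z hz
    refine ENNReal.ofReal_le_ofReal (Real.exp_le_exp.2 ?_)
    have : c * n < energy z := hz
    linarith
  have h1 := ENNReal.toReal_mono (by finiteness) ((mul_le_mul_right (measure_mono hsub) _).trans hmarkov)
  rw [ENNReal.toReal_mul, ENNReal.toReal_ofReal (Real.exp_pos _).le, ENNReal.toReal_pow,
    ENNReal.toReal_ofNat] at h1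
  change Real.exp (c * n / 2) * (noiseLaw N n r).real _ ≤ _ at h1
  have h2 : (2 : ℝ) ^ (n * N r) ≤ Real.exp (n * N r) := by
    have : (2 : ℝ) ≤ Real.exp 1 := by
      have := Real.add_one_le_exp 1
      linarith
    calc (2 : ℝ) ^ (n * N r) ≤ Real.exp 1 ^ (n * N r) := by gcongr
      _ = _ := by rw [← Real.exp_nat_mul]; push_cast; ring_nf
  have h3 : Real.exp (n * N r) ≤ Real.exp (c * n / 2) * Real.exp (-n) := by
    rw [← Real.exp_add]
    refine Real.exp_le_exp.2 ?_
    rw [hc]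
    have : (0 : ℝ) ≤ n := Nat.cast_nonneg _
    nlinarith
  exact le_of_mul_le_mul_left (h1.trans (h2.trans h3)) (Real.exp_pos _)

/-! ### The linear precoding scheme -/

section Scheme

variable {Q : Fin 2 → Fin 2 → ℕ} {n q K₀ : ℕ}

/-- The symbols sent in one stream: every stream uses the same scalar codebook. -/
def streamSymbol (Q : Fin 2 → Fin 2 → ℕ) (C : Fin K₀ → Fin n → Fin q) (Δ : ℝ) (r t : Fin 2)
    (w : Fin (K₀ ^ Q r t)) (k : Fin n) (i : Fin (Q r t)) : ℝ :=
  Δ * (C (finFunctionFinEquiv.symm w i) k : ℕ)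

/-- Linear precoding of independently coded streams, decoded by zero forcing, quantization and
decoding of the scalar code. -/
def streamCode (V : Precoder M Q) (φ : ∀ r t : Fin 2, Fin (Q r t) → (Fin (N r) → ℂ) →ₗ[ℝ] ℝ)
    (C : Fin K₀ → Fin n → Fin q) (hq : 0 < q) (hK : 0 < K₀) (Δ : ℝ) (e : ℕ) :
    Code M N n (fun r t => K₀ ^ Q r t) where
  enc t w k := ∑ r, ∑ i, streamSymbol Q C Δ r t (w r) k i • V r t i
  dec r y t := finFunctionFinEquiv fun i =>
    hammingDecode hK C e fun k => quantize hq (φ r t i (y k) / Δ)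
  measurable_dec r := by
    refine measurable_pi_iff.2 fun t => ?_
    have hφ : ∀ i, Measurable (φ r t i) := fun i =>
      (LinearMap.continuous_of_finiteDimensional (φ r t i)).measurable
    have h1 : Measurable fun (y : Fin n → Fin (N r) → ℂ) (i : Fin (Q r t)) (k : Fin n) =>
        quantize hq (φ r t i (y k) / Δ) :=
      measurable_pi_iff.2 fun i => measurable_pi_iff.2 fun k =>
        (measurable_quantize hq).comp (((hφ i).comp (measurable_pi_apply k)).div_const Δ)
    have h2 : Measurable fun g : Fin (Q r t) → Fin n → Fin q =>
        (finFunctionFinEquiv fun i => hammingDecode hK C e (g i) : Fin (K₀ ^ Q r t)) :=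
      Measurable.of_discrete
    exact h2.comp h1

variable {V : Precoder M Q} {φ : ∀ r t : Fin 2, Fin (Q r t) → (Fin (N r) → ℂ) →ₗ[ℝ] ℝ}
  {C : Fin K₀ → Fin n → Fin q} {hq : 0 < q} {hK : 0 < K₀} {Δ : ℝ} {e : ℕ}

theorem streamCode_usesPrecoder : (streamCode V φ C hq hK Δ e).UsesPrecoder V :=
  ⟨streamSymbol Q C Δ, fun _ _ _ => rfl⟩

/-- The transmit power of a precoder whose symbols all have modulus one. -/
def peakPower (V : Precoder M Q) : ℝ := ∑ t, ∑ j, (∑ r, ∑ i, ‖V r t i j‖) ^ 2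

theorem peakPower_nonneg (V : Precoder M Q) : 0 ≤ peakPower V := by
  unfold peakPower; positivity

theorem streamCode_hasPower {ρ : ℝ} (hΔ : 0 ≤ Δ) (hρ : (Δ * q) ^ 2 * peakPower V ≤ ρ) :
    (streamCode V φ C hq hK Δ e).HasPower ρ := by
  intro t w
  have hsym : ∀ r k i, |streamSymbol Q C Δ r t (w r) k i| ≤ Δ * q := by
    intro r k i
    rw [streamSymbol, abs_of_nonneg (by positivity)]
    gcongr
    exact (Fin.is_lt _).le
  have hk : ∀ k, ∑ j, ‖(streamCode V φ C hq hK Δ e).enc t w k j‖ ^ 2 ≤ ρ := by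
    intro k
    refine le_trans ?_ hρ
    calc _ ≤ ∑ j, ((Δ * q) * ∑ r, ∑ i, ‖V r t i j‖) ^ 2 := by
          refine Finset.sum_le_sum fun j _ => ?_
          gcongr
          simp only [streamCode, Finset.sum_apply, Pi.smul_apply, Finset.mul_sum]
          refine (norm_sum_le _ _).trans (Finset.sum_le_sum fun r _ => ?_)
          refine (norm_sum_le _ _).trans (Finset.sum_le_sum fun i _ => ?_)
          rw [norm_smul, Real.norm_eq_abs]
          exact mul_le_mul_of_nonneg_right (hsym r k i) (norm_nonneg _)
      _ = (Δ * q) ^ 2 * ∑ j, (∑ r, ∑ i, ‖V r t i j‖) ^ 2 := by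
          rw [Finset.mul_sum]
          exact Finset.sum_congr rfl fun j _ => mul_pow _ _ _
      _ ≤ _ := by
          gcongr
          exact Finset.single_le_sum
            (f := fun t => ∑ j, (∑ r, ∑ i, ‖V r t i j‖) ^ 2)
            (fun t _ => by positivity) (Finset.mem_univ t)
  calc _ ≤ ∑ _k : Fin n, ρ := Finset.sum_le_sum fun k _ => hk k
    _ = n * ρ := by simp

/-- Each stream sees a real scalar channel. The noises of different streams may be correlated; the
error analysis needs no independence. -/
theorem zeroForcing_output (H : Channel M N)
    (hφ : ∀ r t i t' i', φ r t i (H.mat r t' *ᵥ V r t' i') =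
        if (⟨t', i'⟩ : Σ t : Fin 2, Fin (Q r t)) = ⟨t, i⟩ then 1 else 0)
    (hφ0 : ∀ r t i t' i', φ r t i (H.mat r t' *ᵥ V r.rev t' i') = 0)
    (w : ∀ r t : Fin 2, Fin (K₀ ^ Q r t)) (r t : Fin 2) (i : Fin (Q r t))
    (z : Fin n → Fin (N r) → ℂ) (k : Fin n) :
    φ r t i ((streamCode V φ C hq hK Δ e).output H w r z k) =
      streamSymbol Q C Δ r t (w r t) k i + φ r t i (z k) := by
  have hlin : ∀ t', H.mat r t' *ᵥ (streamCode V φ C hq hK Δ e).enc t' (fun s => w s t') k =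
      ∑ s, ∑ i', streamSymbol Q C Δ s t' (w s t') k i' • (H.mat r t' *ᵥ V s t' i') := by
    intro t'
    change link M N r t' H (∑ s, ∑ i', streamSymbol Q C Δ s t' (w s t') k i' • V s t' i') = _
    simp only [map_sum, map_smul]
    rfl
  have hsplit : ∀ f : Fin 2 → Fin (N r) → ℂ, ∑ s, f s = f r + f r.rev := by
    intro f
    fin_cases r
    · simp [Fin.sum_univ_two]
    · simp [Fin.sum_univ_two, add_comm]
  have hone : ∀ t', φ r t i
      (H.mat r t' *ᵥ (streamCode V φ C hq hK Δ e).enc t' (fun s => w s t') k) =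
      ∑ i', streamSymbol Q C Δ r t' (w r t') k i' *
        if (⟨t', i'⟩ : Σ t : Fin 2, Fin (Q r t)) = ⟨t, i⟩ then 1 else 0 := by
    intro t'
    rw [hlin, hsplit]
    simp only [map_add, map_sum, map_smul, hφ0, hφ, smul_eq_mul, mul_zero,
      Finset.sum_const_zero, add_zero]
  rw [Code.output, map_add, map_sum]
  congr 1
  simp only [hone]
  rw [← Fintype.sum_sigma' (fun t' i' => streamSymbol Q C Δ r t' (w r t') k i' *
    if (⟨t', i'⟩ : Σ t : Fin 2, Fin (Q r t)) = ⟨t, i⟩ then 1 else 0)]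
  simp

/-- A letter can be misread only where the noise functional is at least Δ / 2. Each such channel use
consumes Δ² / 4 of a total of at most L E, so at most e letters are wrong, which the scalar code
corrects. -/
theorem streamCode_dec_eq (H : Channel M N)
    (hφ : ∀ r t i t' i', φ r t i (H.mat r t' *ᵥ V r t' i') =
        if (⟨t', i'⟩ : Σ t : Fin 2, Fin (Q r t)) = ⟨t, i⟩ then 1 else 0)
    (hφ0 : ∀ r t i t' i', φ r t i (H.mat r t' *ᵥ V r.rev t' i') = 0)
    {L : ℝ} (hL : ∀ r t i z, φ r t i z ^ 2 ≤ L * ∑ j, ‖z j‖ ^ 2) (hL0 : 0 ≤ L) (hΔ : 0 < Δ)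
    (hC : ∀ i j, i ≠ j → 2 * e < hammingDist (C i) (C j)) {E : ℝ}
    (he : 4 * L * E / Δ ^ 2 < e + 1) (w : ∀ r t : Fin 2, Fin (K₀ ^ Q r t)) (r : Fin 2)
    (z : Fin n → Fin (N r) → ℂ) (hz : energy z ≤ E) :
    (streamCode V φ C hq hK Δ e).dec r ((streamCode V φ C hq hK Δ e).output H w r z) = w r := by
  classical
  funext t
  change finFunctionFinEquiv (fun i => hammingDecode hK C e fun k => quantize hq
    (φ r t i ((streamCode V φ C hq hK Δ e).output H w r z k) / Δ)) = w r t
  rw [← Equiv.eq_symm_apply]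
  funext i
  refine hammingDecode_eq hK hC ?_
  set c := C (finFunctionFinEquiv.symm (w r t) i) with hc
  set S : Finset (Fin n) := Finset.univ.filter fun k => Δ / 2 ≤ |φ r t i (z k)| with hS
  have hdist : hammingDist c (fun k => quantize hq
      (φ r t i ((streamCode V φ C hq hK Δ e).output H w r z k) / Δ)) ≤ S.card := by
    refine Finset.card_le_card fun k hk => ?_
    rw [Finset.mem_filter] at hk ⊢
    refine ⟨Finset.mem_univ k, ?_⟩
    by_contra hlt
    refine hk.2 (quantize_eq hq ?_).symm
    rw [zeroForcing_output H hφ hφ0, streamSymbol, ← hc, add_div, mul_div_cancel_left₀ _ hΔ.ne',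
      add_sub_cancel_left, abs_div, abs_of_pos hΔ, div_lt_iff₀ hΔ]
    linarith [not_le.1 hlt]
  have hcount : (S.card : ℝ) * (Δ / 2) ^ 2 ≤ L * E := by
    calc (S.card : ℝ) * (Δ / 2) ^ 2 = ∑ _k ∈ S, (Δ / 2) ^ 2 := by simp
      _ ≤ ∑ k ∈ S, φ r t i (z k) ^ 2 := by
          refine Finset.sum_le_sum fun k hk => ?_
          rw [← sq_abs (φ r t i (z k))]
          have := (Finset.mem_filter.1 hk).2
          gcongr
      _ ≤ ∑ k, φ r t i (z k) ^ 2 :=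
          Finset.sum_le_sum_of_subset_of_nonneg (Finset.subset_univ _) fun k _ _ => sq_nonneg _
      _ ≤ ∑ k, L * ∑ j, ‖z k j‖ ^ 2 := Finset.sum_le_sum fun k _ => hL r t i (z k)
      _ = L * energy z := by rw [energy, Finset.mul_sum]
      _ ≤ L * E := by gcongr
  have hlt : (S.card : ℝ) < e + 1 := by
    refine lt_of_le_of_lt ?_ he
    rw [le_div_iff₀ (by positivity)]
    linarith
  have : S.card ≤ e := by
    have : S.card < e + 1 := by exact_mod_cast hlt
    lia
  exact hdist.trans this

theorem streamCode_errorProb_le (H : Channel M N)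
    (hφ : ∀ r t i t' i', φ r t i (H.mat r t' *ᵥ V r t' i') =
        if (⟨t', i'⟩ : Σ t : Fin 2, Fin (Q r t)) = ⟨t, i⟩ then 1 else 0)
    (hφ0 : ∀ r t i t' i', φ r t i (H.mat r t' *ᵥ V r.rev t' i') = 0)
    {L : ℝ} (hL : ∀ r t i z, φ r t i z ^ 2 ≤ L * ∑ j, ‖z j‖ ^ 2) (hL0 : 0 ≤ L) (hΔ : 0 < Δ)
    (hC : ∀ i j, i ≠ j → 2 * e < hammingDist (C i) (C j))
    (he : 4 * L * ((2 * (N 0 + N 1 + 1) : ℝ) * n) / Δ ^ 2 < e + 1) (r : Fin 2) :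
    (streamCode V φ C hq hK Δ e).errorProb H r ≤ Real.exp (-n) := by
  rw [Code.errorProb]
  refine div_le_of_le_mul₀ (Nat.cast_nonneg _) (Real.exp_pos _).le ?_
  calc _ ≤ ∑ _w : ∀ r t : Fin 2, Fin (K₀ ^ Q r t), Real.exp (-n) := by
        refine Finset.sum_le_sum fun w _ => ?_
        refine (measureReal_mono fun z hz => ?_).trans (noiseLaw_energy_gt_le N n r)
        by_contra hlt
        exact hz (streamCode_dec_eq H hφ hφ0 hL hL0 hΔ hC he w r z (not_lt.1 hlt))
    _ = _ := by simp [mul_comm]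

end Scheme

/-! ### Asymptotics of the rate, and achievability. -/

/-- The rate of each stream of the scheme at power `2 ^ T`. -/
def streamRate (P κ T : ℝ) : ℝ := (1 - κ / T ^ 2) * (T / 2 - Real.logb 2 (2 * √P * T)) - 1

theorem tendsto_logb_mul_div {c : ℝ} (hc : 0 < c) :
    Tendsto (fun T => Real.logb 2 (c * T) / T) atTop (𝓝 0) := by
  have h1 : Tendsto (fun T : ℝ => Real.log T / T) atTop (𝓝 0) :=
    Real.isLittleO_log_id_atTop.tendsto_div_nhds_zero
  have h2 : Tendsto (fun T : ℝ => Real.log c / T) atTop (𝓝 0) :=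
    tendsto_const_nhds.div_atTop tendsto_id
  have h3 := (h2.add h1).div_const (Real.log 2)
  rw [add_zero, zero_div] at h3
  refine h3.congr' ?_
  filter_upwards [eventually_gt_atTop 0] with T hT
  rw [Real.logb, Real.log_mul hc.ne' hT.ne']
  ring

theorem tendsto_gap_div {P : ℝ} (hP : 0 < P) :
    Tendsto (fun T => (T / 2 - Real.logb 2 (2 * √P * T)) / T) atTop (𝓝 (1 / 2)) := by
  have h := (tendsto_const_nhds (x := (1 / 2 : ℝ))).sub
    (tendsto_logb_mul_div (c := 2 * √P) (by positivity))
  rw [sub_zero] at h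
  refine h.congr' ?_
  filter_upwards [eventually_gt_atTop 0] with T hT
  field_simp

theorem tendsto_streamRate_div {P : ℝ} (hP : 0 < P) (κ : ℝ) :
    Tendsto (fun T => streamRate P κ T / T) atTop (𝓝 (1 / 2)) := by
  have h1 : Tendsto (fun T : ℝ => 1 - κ / T ^ 2) atTop (𝓝 (1 - 0)) :=
    tendsto_const_nhds.sub (tendsto_const_nhds.div_atTop (tendsto_pow_atTop two_ne_zero))
  rw [sub_zero] at h1
  have h2 := (h1.mul (tendsto_gap_div hP)).sub
    ((tendsto_const_nhds (x := (1 : ℝ))).div_atTop tendsto_id)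
  rw [one_mul, sub_zero] at h2
  refine h2.congr fun T => ?_
  simp only [streamRate, id]
  ring

theorem eventually_pos_of_tendsto_div {f : ℝ → ℝ} {a : ℝ} (ha : 0 < a)
    (h : Tendsto (fun T => f T / T) atTop (𝓝 a)) : ∀ᶠ T in atTop, 0 < f T := by
  filter_upwards [h.eventually_const_lt ha, eventually_gt_atTop 0] with T h1 h2
  exact (div_pos_iff_of_pos_right h2).1 h1

/-- A code of relative distance `δ` over an alphabet of at least `2 ^ G` letters with nearly
maximal rate. -/
theorem rpow_le_of_code {n q d K : ℕ} {G δ : ℝ} (hG : 0 ≤ G) (hq : (2 : ℝ) ^ G ≤ q)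
    (hd : (d : ℝ) ≤ δ * n) (hδ : δ ≤ 1) (h : q ^ n ≤ K * (2 ^ n * q ^ d)) :
    (2 : ℝ) ^ ((n : ℝ) * ((1 - δ) * G - 1)) ≤ K := by
  have hn : (0 : ℝ) ≤ n := Nat.cast_nonneg _
  have hq1 : (1 : ℝ) ≤ q := (Real.one_le_rpow (by norm_num) hG).trans hq
  have hq0 : (0 : ℝ) < q := by linarith
  have h' : (q : ℝ) ^ n ≤ K * (2 ^ n * q ^ d) := by exact_mod_cast h
  have h1 : (2 : ℝ) ^ (n * ((1 - δ) * G)) ≤ (q : ℝ) ^ (n - d : ℝ) := by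
    calc (2 : ℝ) ^ (n * ((1 - δ) * G)) = ((2 : ℝ) ^ G) ^ (n * (1 - δ)) := by
          rw [← Real.rpow_mul (by norm_num)]; ring_nf
      _ ≤ (q : ℝ) ^ (n * (1 - δ)) :=
          Real.rpow_le_rpow (by positivity) hq (mul_nonneg hn (by linarith))
      _ ≤ (q : ℝ) ^ (n - d : ℝ) := Real.rpow_le_rpow_of_exponent_le hq1 (by linarith)
  have h2 : (q : ℝ) ^ (n - d : ℝ) = q ^ n / q ^ d := by
    rw [Real.rpow_sub hq0, Real.rpow_natCast, Real.rpow_natCast]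
  calc (2 : ℝ) ^ ((n : ℝ) * ((1 - δ) * G - 1)) = 2 ^ (n * ((1 - δ) * G)) / 2 ^ n := by
        rw [mul_sub, mul_one, Real.rpow_sub (by norm_num), Real.rpow_natCast]
    _ ≤ (q ^ n / q ^ d) / 2 ^ n := by rw [← h2]; gcongr
    _ ≤ K := by
        rw [div_div, div_le_iff₀ (by positivity)]
        linarith

/-- An aligned precoder achieves half a degree of freedom per real symbol. -/
theorem IsAligned.dofAchievableWith {H : Channel M N} {Q : Fin 2 → Fin 2 → ℕ} {V : Precoder M Q}
    {A : Fin 2 → ℕ} (h : IsAligned H V A) :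
    DoFAchievableWith H V fun r t => (Q r t : ℝ) / 2 := by
  obtain ⟨φ, hφ, hφ0⟩ := h.exists_zeroForcing
  choose L hL0 hL using fun r t i => exists_sq_le_energy (φ r t i)
  set Λ : ℝ := ∑ r, ∑ t, ∑ i, L r t i with hΛ
  have hΛ0 : 0 ≤ Λ := Finset.sum_nonneg fun r _ => Finset.sum_nonneg fun t _ =>
    Finset.sum_nonneg fun i _ => hL0 r t i
  have hLΛ : ∀ r t i, L r t i ≤ Λ := by
    intro r t i
    calc L r t i ≤ ∑ i, L r t i :=
          Finset.single_le_sum (f := fun i => L r t i) (fun i _ => hL0 r t i) (Finset.mem_univ i)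
      _ ≤ ∑ t, ∑ i, L r t i := Finset.single_le_sum (f := fun t => ∑ i, L r t i)
          (fun t _ => Finset.sum_nonneg fun i _ => hL0 r t i) (Finset.mem_univ t)
      _ ≤ Λ := Finset.single_le_sum (f := fun r => ∑ t, ∑ i, L r t i)
          (fun r _ => Finset.sum_nonneg fun t _ => Finset.sum_nonneg fun i _ => hL0 r t i)
          (Finset.mem_univ r)
  have hφL : ∀ r t i z, φ r t i z ^ 2 ≤ Λ * ∑ j, ‖z j‖ ^ 2 := fun r t i z =>
    (hL r t i z).trans (mul_le_mul_of_nonneg_right (hLΛ r t i) (by positivity))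
  set P : ℝ := peakPower V + 1 with hP
  have hP0 : 0 < P := by have := peakPower_nonneg V; linarith
  set c₀ : ℝ := 2 * (N 0 + N 1 + 1) with hc₀
  have hc₀0 : 0 ≤ c₀ := by positivity
  -- With spacing T and noise energy at most c₀ n, at most 4 Λ c₀ n / T² letters are wrong; twice
  -- this fraction is the relative distance κ / T².
  set κ : ℝ := 8 * Λ * c₀ with hκ
  have hlog : Tendsto (Real.logb 2) atTop atTop := Real.tendsto_logb_atTop (by norm_num)
  refine ⟨fun ρ r t => Q r t * streamRate P κ (Real.logb 2 ρ), ?_, fun r t => ?_⟩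
  · have hκT : ∀ᶠ T : ℝ in atTop, κ / T ^ 2 ≤ 1 := by
      have : Tendsto (fun T : ℝ => κ / T ^ 2) atTop (𝓝 0) :=
        tendsto_const_nhds.div_atTop (tendsto_pow_atTop two_ne_zero)
      exact (this.eventually_lt_const one_pos).mono fun T hT => hT.le
    have hrate := eventually_pos_of_tendsto_div (by norm_num) (tendsto_streamRate_div hP0 κ)
    have hgap := eventually_pos_of_tendsto_div (by norm_num) (tendsto_gap_div hP0)
    filter_upwards [hlog.eventually hκT, hlog.eventually hrate, hlog.eventually hgap,
      hlog.eventually (eventually_gt_atTop 0), eventually_gt_atTop 0] with ρ h1 h2 h3 hT hρ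
    -- T is also the spacing of the constellation: its growth makes the misread fraction O(1 / T²)
    -- and costs only about log₂ T bits. 2 ^ G equals √ρ / (2 √P T), so q ≤ 2 · 2 ^ G keeps T q
    -- below √ρ / √P.
    set T : ℝ := Real.logb 2 ρ with hTdef
    set G : ℝ := T / 2 - Real.logb 2 (2 * √P * T) with hG
    refine ⟨fun r t => mul_nonneg (Nat.cast_nonneg _) h2.le, fun ε hε => ?_⟩
    have hexp : Tendsto (fun n : ℕ => Real.exp (-(n : ℝ))) atTop (𝓝 0) :=
      Real.tendsto_exp_neg_atTop_nhds_zero.comp tendsto_natCast_atTop_atTop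
    filter_upwards [hexp.eventually_lt_const hε] with n hn
    have hG1 : (1 : ℝ) ≤ 2 ^ G := Real.one_le_rpow (by norm_num) h3.le
    -- Because 2 ^ G ≥ 1, the factor 2 lets the floor stay above 2 ^ G.
    set q : ℕ := ⌊2 * (2 : ℝ) ^ G⌋₊ with hqdef
    have hqle : (q : ℝ) ≤ 2 * 2 ^ G := Nat.floor_le (by positivity)
    have hqge : (2 : ℝ) ^ G ≤ q := by
      have := Nat.lt_floor_add_one (2 * (2 : ℝ) ^ G)
      linarith
    have hq : 0 < q := by
      have : (0 : ℝ) < q := by linarith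
      exact_mod_cast this
    set e : ℕ := ⌊4 * Λ * (c₀ * n) / T ^ 2⌋₊ with he
    obtain ⟨K₀, C, hC, hcard⟩ := exists_code_hammingDist n q (2 * e) hq
    have hK : 0 < K₀ := by
      rcases Nat.eq_zero_or_pos K₀ with h0 | h0
      · rw [h0, zero_mul] at hcard
        exact absurd hcard (not_le.2 (pow_pos hq n))
      · exact h0
    have hed : ((2 * e : ℕ) : ℝ) ≤ κ / T ^ 2 * n := by
      have : (e : ℝ) ≤ 4 * Λ * (c₀ * n) / T ^ 2 := Nat.floor_le (by positivity)
      push_cast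
      calc 2 * (e : ℝ) ≤ 2 * (4 * Λ * (c₀ * n) / T ^ 2) := by gcongr
        _ = κ / T ^ 2 * n := by rw [hκ]; ring
    refine ⟨fun r t => K₀ ^ Q r t, streamCode V φ C hq hK T e, streamCode_usesPrecoder,
      streamCode_hasPower hT.le ?_, fun r t => ?_, fun r => ?_⟩
    · have h2G : (2 : ℝ) ^ G = √ρ / (2 * √P * T) := by
        rw [hG, Real.rpow_sub (by norm_num), Real.rpow_logb (by norm_num) (by norm_num)
          (by positivity), hTdef, div_eq_mul_one_div (Real.logb 2 ρ), Real.rpow_mul (by norm_num),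
          Real.rpow_logb (by norm_num) (by norm_num) hρ, ← Real.sqrt_eq_rpow]
      have hTq : T * q ≤ √ρ / √P := by
        calc T * q ≤ T * (2 * 2 ^ G) := by gcongr
          _ = √ρ / √P := by
            rw [h2G]
            field_simp
      calc (T * q) ^ 2 * peakPower V ≤ (√ρ / √P) ^ 2 * P := by
            have := peakPower_nonneg V
            gcongr
            linarith
        _ = ρ := by
            rw [div_pow, Real.sq_sqrt hρ.le, Real.sq_sqrt hP0.le]
            field_simp
    · have hR := rpow_le_of_code h3.le hqge hed h1 hcard
      push_cast
      calc (2 : ℝ) ^ ((n : ℝ) * (Q r t * streamRate P κ T))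
          = ((2 : ℝ) ^ ((n : ℝ) * streamRate P κ T)) ^ Q r t := by
            rw [← Real.rpow_natCast, ← Real.rpow_mul (by norm_num)]
            ring_nf
        _ ≤ (K₀ : ℝ) ^ Q r t := by
            gcongr
            exact hR
    · exact (streamCode_errorProb_le H hφ hφ0 hφL hΛ0 hT hC (Nat.lt_floor_add_one _) r).trans
        hn.le
  · have h4 := ((tendsto_streamRate_div hP0 κ).comp hlog).const_mul (Q r t : ℝ)
    refine (h4.congr fun ρ => ?_).trans (le_of_eq ?_)
    · simp only [Function.comp_apply]
      ring
    · congr 1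
      ring

theorem exists_left_inverse_of_mulVec_injective {m d : ℕ} {A : Matrix (Fin m) (Fin d) ℂ}
    (h : Function.Injective fun u => A *ᵥ u) :
    ∃ L : Matrix (Fin d) (Fin m) ℂ, L * A = 1 := by
  obtain ⟨g, hg⟩ := (Matrix.toLin' A).exists_leftInverse_of_injective
    (LinearMap.ker_eq_bot.2 h)
  refine ⟨LinearMap.toMatrix' g, ?_⟩
  rw [← LinearMap.toMatrix'_id, ← hg, LinearMap.toMatrix'_comp, LinearMap.toMatrix'_toLin']

end XChannel

end

/-! ### The theorem. -/

theorem theorem4 (M N : Fin 2 → ℕ)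
    (hN : N 1 ≤ N 0) (hNM : M 0 ≤ N 1) (hM : M 1 ≤ M 0)
    (hlow : 3 * M 1 < N 0 + N 1) (hup : N 0 + N 1 < 2 * M 0 + M 1)
    (v : Fin 2 → Fin 2 → ℝ≥0) (hv : ∀ r t, v r t ≠ 0) :
    ∃ Q : Fin 2 → Fin 2 → ℕ,
      -- the lengths of the four message blocks
      (Q 0 0 : ℤ) = N 0 - N 1 + M 1 ∧ (Q 0 1 : ℤ) = N 0 - N 1 + M 1 ∧
      (Q 1 0 : ℤ) = 2 * (N 1 - M 1) ∧ (Q 1 1 : ℤ) = N 1 - N 0 + M 1 ∧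
      (∑ r, ∑ t, (Q r t : ℝ) / 2) = ((N 0 : ℝ) + N 1 + M 1) / 2 ∧
      ∀ᵐ H ∂(XChannel.channelLaw M N v),
        -- an interference alignment precoder with these lengths, each real symbol carrying 1/2
        (∃ (V : XChannel.Precoder M Q) (A : Fin 2 → ℕ), XChannel.IsAligned H V A ∧
          XChannel.DoFAchievableWith H V (fun r t => (Q r t : ℝ) / 2)) ∧
        -- the total is attained, and no coding scheme whatsoever does better
        IsGreatest {D : ℝ | ∃ d : Fin 2 → Fin 2 → ℝ,
            XChannel.DoFAchievable H d ∧ D = ∑ r, ∑ t, d r t}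
          (((N 0 : ℝ) + N 1 + M 1) / 2) := by
  obtain ⟨a, ha⟩ : ∃ a, a + N 1 = N 0 + M 1 := ⟨N 0 + M 1 - N 1, by lia⟩
  -- N 0 ≤ N 1 + M 1 follows from `hup` and M 0 ≤ N 1.
  obtain ⟨b, hb⟩ : ∃ b, b + N 0 = N 1 + M 1 := ⟨N 1 + M 1 - N 0, by lia⟩
  obtain ⟨f, hf⟩ : ∃ f, f + 3 * M 1 = N 0 + N 1 := ⟨N 0 + N 1 - 3 * M 1, by lia⟩
  -- 2m is the real dimension of the kernel of a generic `sharedLink M N 1 H`, the slack in the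
  -- choice of the alignment spaces.
  obtain ⟨m, hm⟩ : ∃ m, m + N 0 + N 1 = 2 * M 0 + M 1 := ⟨2 * M 0 + M 1 - (N 0 + N 1), by lia⟩
  have haZ : (a : ℤ) + N 1 = N 0 + M 1 := by exact_mod_cast ha
  have hbZ : (b : ℤ) + N 0 = N 1 + M 1 := by exact_mod_cast hb
  have hfZ : (f : ℤ) + 3 * M 1 = N 0 + N 1 := by exact_mod_cast hf
  have hsum : (∑ r, ∑ t, (XChannel.blockLength a b f r t : ℝ) / 2) =
      ((N 0 : ℝ) + N 1 + M 1) / 2 := by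
    have haR : (a : ℝ) + N 1 = N 0 + M 1 := by exact_mod_cast ha
    have hbR : (b : ℝ) + N 0 = N 1 + M 1 := by exact_mod_cast hb
    have hfR : (f : ℝ) + 3 * M 1 = N 0 + N 1 := by exact_mod_cast hf
    simp only [Fin.sum_univ_two, XChannel.blockLength]
    push_cast
    linarith
  refine ⟨XChannel.blockLength a b f, ?_, ?_, ?_, ?_, hsum, ?_⟩
  · simp only [XChannel.blockLength]; linarith
  · simp only [XChannel.blockLength]; linarith
  · simp only [XChannel.blockLength]; push_cast; linarith
  · simp only [XChannel.blockLength]; linarith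
  filter_upwards [XChannel.ae_exists_isAligned hN hNM hM ha hb hf hm hv] with H hH
  obtain ⟨hinj, V, hV⟩ := hH
  have hach := hV.dofAchievableWith
  refine ⟨⟨V, _, hV, hach⟩, ⟨_, ?_, hsum.symm⟩, ?_⟩
  · obtain ⟨R, hR, hlim⟩ := hach
    refine ⟨R, hR.mono fun ρ hρ => ⟨hρ.1, fun ε hε => (hρ.2 ε hε).mono ?_⟩, hlim⟩
    rintro n ⟨K, c, -, hc⟩
    exact ⟨K, c, trivial, hc⟩
  · rintro D ⟨d, hd, rfl⟩
    have hleft : ∀ r, ∃ L : Matrix (Fin (M 0)) (Fin (N r)) ℂ, L * H.mat r 0 = 1 := fun r =>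
      XChannel.exists_left_inverse_of_mulVec_injective (hinj r 0)
    choose L hL using hleft
    exact XChannel.total_dof_le H L hL hd
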